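/- Let $d\ge 2$, let $G=\mathrm{SO}^\circ(d,1)$ be the identity component of $\mathrm{SO}(Q)$ for $Q(x)=2x_1x_{d+1}+x_2^2+\cdots+x_d^2$, acting on $\mathbb H^d$ and on its sphere at infinity $\mathbb S^{d-1}$, and let $\Gamma<G$ be a discrete torsion-free subgroup with limit set $\Lambda\subset\mathbb S^{d-1}$. Assume that $M=\Gamma\backslash\mathbb H^d$ is a convex cocompact hyperbolic manifold with non-empty Fuchsian ends: $\operatorname{core}M=\Gamma\backslash\operatorname{hull}(\Lambda)$ is compact, and $\mathbb S^{d-1}-\Lambda=\bigcup_{i=1}^\infty B_i$ is a dense union of infinitely many round balls $B_i$ with mutually disjoint closures. Let $N^{-}=\{\exp u^-(x):x\in\mathbb R^{d-1}\}$ and $N^{+}=\{\exp u^+(x):x\in\mathbb R^{d-1}\}$, where $$u^-(x)=\begin{pmatrix}0&x^t&0\\0&0&-x\\0&0&0\end{pmatrix},\qquad u^+(x)=\begin{pmatrix}0&0&0\\x&0&0\\0&-x^t&0\end{pmatrix},$$ be the two horospherical subgroups. For $g\in G$ let $g^+$ and $g^-$ in $\mathbb S^{d-1}$ be the isotropic lines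 spanned by $ge_1$ and $ge_{d+1}$ (the forward and backward end points of the geodesic of the frame $g$), and let $$\operatorname{RF}M=\{[g]\in\Gamma\backslash G:\ g^{+}\in\Lambda\text{ and }g^-\in\Lambda\}.$$ The double of $\operatorname{core}M$ along its boundary is a closed hyperbolic manifold; its systole is the length of its shortest closed geodesic. Then there is a constant $k>1$, depending only on the systole of the double of $\operatorname{core}M$ (in particular not otherwise on $d$ or $\Gamma$), such that for every one-parameter subgroup $\{u_t:t\in\mathbb R\}$ of $N^-$ or of $N^+$ and every $y\in\operatorname{RF}M$, the set $$\mathsf T(y)=\{t\in\mathbb R:\ yu_t\in\operatorname{RF}M\}$$ is globally $k$-thick, that is: $\mathsf T(y)$ is closed and non-empty, and for every $t\in\mathsf T(y)$ and every $\lambda>0$, $$\mathsf T(y)\cap\big([t-k\lambda,\,t-\lambda]\cup[t+\lambda,\,t+k\lambda]\big)\ne\emptyset .$$ -/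

import Mathlib

open Set Filter Topology

noncomputable section

namespace FuchsianEnds

/-! ### The form `Q`, the group `G = SO°(Q)` and hyperbolic space -/

/-- Coordinates `(x₁ ; x₂, …, x_d ; x_{d+1})` of `ℝ^{d+1}`: first, middle block of size `d - 1`,
last. -/
abbrev Idx (d : ℕ) : Type := Unit ⊕ (Fin (d - 1) ⊕ Unit)

/-- The space `ℝ^{d+1}`. -/
abbrev Vec (d : ℕ) : Type := Idx d → ℝ

/-- First coordinate. -/
abbrev fstI (d : ℕ) : Idx d := Sum.inl ()
/-- Middle coordinates. -/
abbrev midI {d : ℕ} (i : Fin (d - 1)) : Idx d := Sum.inr (Sum.inl i)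
/-- Last coordinate. -/
abbrev lstI (d : ℕ) : Idx d := Sum.inr (Sum.inr ())

/-- The symmetric bilinear form of `Q(x) = 2 x₁ x_{d+1} + x₂² + ⋯ + x_d²`. -/
def form {d : ℕ} (v w : Vec d) : ℝ :=
  v (fstI d) * w (lstI d) + v (lstI d) * w (fstI d) + ∑ i : Fin (d - 1), v (midI i) * w (midI i)

/-- `SO(Q)`: matrices of determinant one that preserve the form. -/
def SOQ (d : ℕ) : Subgroup (Matrix.SpecialLinearGroup (Idx d) ℝ) where
  carrier := {g | ∀ v w : Vec d, form (g.1.mulVec v) (g.1.mulVec w) = form v w}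
  one_mem' := by intro v w; simp
  mul_mem' := by
    intro a b ha hb v w
    have h := ha (b.1.mulVec v) (b.1.mulVec w)
    rw [hb] at h
    simpa [Matrix.mulVec_mulVec] using h
  inv_mem' := by
    intro a ha v w
    have h := ha (((a⁻¹ : Matrix.SpecialLinearGroup (Idx d) ℝ)).1.mulVec v)
      (((a⁻¹ : Matrix.SpecialLinearGroup (Idx d) ℝ)).1.mulVec w)
    have e : a.1 * ((a⁻¹ : Matrix.SpecialLinearGroup (Idx d) ℝ)).1 = 1 := by
      rw [← Matrix.SpecialLinearGroup.coe_mul, mul_inv_cancel,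
        Matrix.SpecialLinearGroup.coe_one]
    rw [Matrix.mulVec_mulVec, Matrix.mulVec_mulVec, e, Matrix.one_mulVec, Matrix.one_mulVec] at h
    exact h.symm

/-- `SO°(Q)`, the identity component of `SO(Q)`. -/
def SO0 (d : ℕ) : Subgroup (SOQ d) := Subgroup.connectedComponentOfOne (SOQ d)

/-- The Lie group `G = SO°(d,1)`, also the oriented frame bundle of `ℍ^d`. -/
abbrev G (d : ℕ) : Type := SO0 d

/-- The underlying matrix of an element of `G`. -/
def G.mat {d : ℕ} (g : G d) : Matrix (Idx d) (Idx d) ℝ := g.1.1.1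

/-- The linear functional `x₁ - x_{d+1}`; it does not vanish on vectors `x ≠ 0` with `Q(x) ≤ 0`. -/
def ht {d : ℕ} (v : Vec d) : ℝ := v (fstI d) - v (lstI d)

/-- Hyperbolic space `ℍ^d`: the sheet `x₁ > x_{d+1}` of the hyperboloid `Q = -1`. -/
def Hyp (d : ℕ) : Type := {v : Vec d // form v v = -1 ∧ 0 < ht v}

instance (d : ℕ) : TopologicalSpace (Hyp d) := instTopologicalSpaceSubtype

lemma ht_ne_zero {d : ℕ} {v : Vec d} (hv : form v v = -1) : ht v ≠ 0 := by
  intro h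
  have h0 : v (fstI d) = v (lstI d) := sub_eq_zero.mp h
  have h1 : 0 ≤ ∑ i : Fin (d - 1), v (midI i) * v (midI i) :=
    Finset.sum_nonneg fun i _ => mul_self_nonneg _
  unfold form at hv
  rw [h0] at hv
  nlinarith [mul_self_nonneg (v (lstI d))]

lemma form_mat {d : ℕ} (g : G d) (v w : Vec d) :
    form (g.mat.mulVec v) (g.mat.mulVec w) = form v w := g.1.2 v w

lemma ht_mat_pos {d : ℕ} (g : G d) (x : Hyp d) : 0 < ht (g.mat.mulVec x.1) := by
  let f : SOQ d → ℝ := fun a => ht (a.1.1.mulVec x.1)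
  have hf : Continuous f := by
    have h1 : Continuous fun a : SOQ d => a.1.1 :=
      continuous_subtype_val.comp continuous_subtype_val
    have h2 : Continuous fun a : SOQ d => a.1.1.mulVec x.1 :=
      h1.matrix_mulVec continuous_const
    exact ((continuous_pi_iff.mp h2) (fstI d)).sub ((continuous_pi_iff.mp h2) (lstI d))
  have hne : ∀ a, f a ≠ 0 := fun a => ht_ne_zero ((a.2 x.1 x.1).trans x.2.1)
  have h1 : 0 < f 1 := by simpa [f] using x.2.2
  by_contra hneg
  have hg : f g.1 ≤ 0 := not_lt.mp hneg
  have hc : IsPreconnected (connectedComponent (1 : SOQ d)) := isPreconnected_connectedComponent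
  obtain ⟨a, -, ha⟩ := hc.intermediate_value (f := f) (g.2 : g.1 ∈ connectedComponent (1 : SOQ d))
    mem_connectedComponent hf.continuousOn ⟨hg, h1.le⟩
  exact hne a ha

/-- `G` acts linearly on `ℍ^d`. -/
instance (d : ℕ) : MulAction (G d) (Hyp d) where
  smul g x := ⟨g.mat.mulVec x.1, (form_mat g x.1 x.1).trans x.2.1, ht_mat_pos g x⟩
  one_smul x := Subtype.ext (Matrix.one_mulVec x.1)
  mul_smul g h x := Subtype.ext (Matrix.mulVec_mulVec x.1 g.mat h.mat).symm

/-- The hyperbolic distance: `cosh d(x,y) = -⟨x,y⟩`. -/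
def hdist {d : ℕ} (x y : Hyp d) : ℝ := Real.arcosh (-form x.1 y.1)

/-- The point `o` with stabilizer `K = {g ∈ G | gᵗ g = 1}`: `o = (1, 0, …, 0, -1) / √2`. -/
def o (d : ℕ) : Hyp d :=
  ⟨Sum.elim (fun _ => (√2)⁻¹) (Sum.elim (fun _ => 0) (fun _ => -(√2)⁻¹)), by
    have h : (√2)⁻¹ * (√2)⁻¹ = (2 : ℝ)⁻¹ := by
      rw [← mul_inv, Real.mul_self_sqrt (by norm_num)]
    constructor
    · simp only [form, Sum.elim_inl, Sum.elim_inr, mul_zero, Finset.sum_const_zero]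
      linarith
    · simp only [ht, Sum.elim_inl, Sum.elim_inr]
      have : (0 : ℝ) < (√2)⁻¹ := by positivity
      linarith⟩

/-! ### The compactification `ℍ^d ∪ 𝕊^{d-1}` (projective model), limit set and convex hull -/

/-- The representative of the line `ℝ v` in the affine chart `x₁ - x_{d+1} = 1`. In this chart
`ℍ^d` is the open ball `Q < 0`, its sphere at infinity is `Q = 0`, and hyperbolic geodesics are
straight segments. -/
def klein {d : ℕ} (v : Vec d) : Vec d := (ht v)⁻¹ • v

/-- The sphere at infinity `𝕊^{d-1}` (isotropic lines). -/
def sphereInf (d : ℕ) : Set (Vec d) := {v | form v v = 0 ∧ ht v = 1}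

/-- `g⁺ = g(∞)`, where `∞ = e⁺ = lim_{t → ∞} a_t o` is the line of the first basis vector. -/
def G.plus {d : ℕ} (g : G d) : Vec d := klein (g.mat.mulVec (Pi.single (fstI d) 1))

/-- `g⁻ = g(0)`, where `0 = e⁻ = lim_{t → -∞} a_t o` is the line of the last basis vector. -/
def G.minus {d : ℕ} (g : G d) : Vec d := klein (g.mat.mulVec (Pi.single (lstI d) 1))

/-- The limit set `Λ ⊆ 𝕊^{d-1}`: all accumulation points at infinity of the orbit `Γ o` in the
compactification `ℍ^d ∪ 𝕊^{d-1}`. -/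
def limitSet {d : ℕ} (Γ : Subgroup (G d)) : Set (Vec d) :=
  {ξ ∈ sphereInf d | AccPt ξ (𝓟 (range fun γ : Γ => klein (γ • o d).1))}

/-- `hull(Λ) ⊆ ℍ^d`, the hyperbolic convex hull of the limit set; since geodesics are straight
segments in the projective model, it is the trace on `ℍ^d` of the affine convex hull. -/
def hull {d : ℕ} (Γ : Subgroup (G d)) : Set (Hyp d) :=
  {x | klein x.1 ∈ convexHull ℝ (limitSet Γ)}

/-- The open round ball of `𝕊^{d-1}` cut out by a spacelike vector `n` (a nonempty intersection of
the sphere with an open half-space, with nonempty exterior). -/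
def roundBall {d : ℕ} (n : Vec d) : Set (Vec d) := {ξ ∈ sphereInf d | 0 < form ξ n}

/-! ### The manifold `M = Γ \ ℍ^d`, its convex core and its frame bundle -/

/-- `M = Γ \ ℍ^d`, with the quotient topology. -/
abbrev Mfd {d : ℕ} (Γ : Subgroup (G d)) : Type := Quotient (MulAction.orbitRel Γ (Hyp d))

/-- `core M = Γ \ hull(Λ)`. -/
def core {d : ℕ} (Γ : Subgroup (G d)) : Set (Mfd Γ) := (fun x => (⟦x⟧ : Mfd Γ)) '' hull Γ

/-- `M = Γ \ ℍ^d` is a convex cocompact hyperbolic manifold with non-empty Fuchsian ends: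
`Γ` is discrete and torsion-free, `core M` is compact, and `Ω = 𝕊^{d-1} - Λ` is a dense union of
infinitely many round balls with mutually disjoint closures. -/
structure IsConvexCocompactFuchsianEnds {d : ℕ} (Γ : Subgroup (G d)) : Prop where
  discrete : DiscreteTopology Γ
  torsionFree : ∀ γ ∈ Γ, IsOfFinOrder γ → γ = 1
  isCompact_core : IsCompact (core Γ)
  exists_balls : ∃ n : ℕ → Vec d, (∀ i, form (n i) (n i) = 1) ∧
    sphereInf d \ limitSet Γ = ⋃ i, roundBall (n i) ∧
    Pairwise (fun i j => Disjoint (closure (roundBall (n i))) (closure (roundBall (n j)))) ∧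
    sphereInf d ⊆ closure (sphereInf d \ limitSet Γ)

/-- `Γ \ G`, the oriented frame bundle of `M`. -/
abbrev FrameBundle {d : ℕ} (Γ : Subgroup (G d)) : Type := Quotient (MulAction.orbitRel Γ (G d))

/-- The right translation `x ↦ x g` of `Γ \ G`. -/
def rightMul {d : ℕ} {Γ : Subgroup (G d)} (x : FrameBundle Γ) (g : G d) : FrameBundle Γ :=
  Quotient.map (· * g) (by
    rintro a b ⟨γ, rfl⟩
    exact ⟨γ, (smul_mul_assoc γ b g).symm⟩) x

/-- The renormalized frame bundle `RF M = {[g] ∈ Γ \ G | g⁺, g⁻ ∈ Λ}`. -/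
def RF {d : ℕ} (Γ : Subgroup (G d)) : Set (FrameBundle Γ) :=
  (fun g => (⟦g⟧ : FrameBundle Γ)) '' {g : G d | g.plus ∈ limitSet Γ ∧ g.minus ∈ limitSet Γ}

/-! ### The double of the convex core and its systole -/

/-- The distance of `M`: the infimum of the distances of representatives. As `hull(Λ)` is convex,
on `core M` it is also the intrinsic path distance of `core M`. -/
def mdist {d : ℕ} {Γ : Subgroup (G d)} (x y : Mfd Γ) : ℝ :=
  sInf {r | ∃ p q : Hyp d, (⟦p⟧ : Mfd Γ) = x ∧ (⟦q⟧ : Mfd Γ) = y ∧ r = hdist p q}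

/-- The boundary of `core M`. -/
def coreBoundary {d : ℕ} (Γ : Subgroup (G d)) : Set (Mfd Γ) := frontier (core Γ)

/-- Two copies of `core M`, the points of the boundary being identified with their copies. -/
def doubleSetoid {d : ℕ} (Γ : Subgroup (G d)) : Setoid (core Γ × Bool) where
  r p q := p.1 = q.1 ∧ (p.2 = q.2 ∨ p.1.1 ∈ coreBoundary Γ)
  iseqv :=
    { refl := fun _ => ⟨rfl, Or.inl rfl⟩
      symm := fun h => ⟨h.1.symm, h.2.elim (fun e => Or.inl e.symm)
        (fun e => Or.inr (h.1 ▸ e))⟩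
      trans := fun h k => ⟨h.1.trans k.1, h.2.elim
        (fun e => k.2.elim (fun e' => Or.inl (e.trans e')) (fun e' => Or.inr (h.1.symm ▸ e')))
        Or.inr⟩ }

/-- The double of `core M`. -/
abbrev Double {d : ℕ} (Γ : Subgroup (G d)) : Type := Quotient (doubleSetoid Γ)

/-- The path distance of the double (the gluing metric): two points of the same copy are joined
inside this copy, and any two points are joined by way of a point of the common boundary. -/
def ddist {d : ℕ} {Γ : Subgroup (G d)} (a b : Double Γ) : ℝ :=
  sInf ({r | ∃ (x y : core Γ) (i : Bool), (⟦(x, i)⟧ : Double Γ) = a ∧ (⟦(y, i)⟧ : Double Γ) = b ∧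
      r = mdist x.1 y.1} ∪
    {r | ∃ (x y z : core Γ) (i j : Bool), (⟦(x, i)⟧ : Double Γ) = a ∧
      (⟦(y, j)⟧ : Double Γ) = b ∧ z.1 ∈ coreBoundary Γ ∧ r = mdist x.1 z.1 + mdist z.1 y.1})

/-- The double contains a closed geodesic of length `ℓ > 0`: an `ℓ`-periodic, unit speed, locally
distance-realizing curve. -/
def HasClosedGeodesic {d : ℕ} (Γ : Subgroup (G d)) (ℓ : ℝ) : Prop :=
  0 < ℓ ∧ ∃ c : ℝ → Double Γ, (∀ t, c (t + ℓ) = c t) ∧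
    ∀ t, ∃ ε > 0, ∀ s ∈ Ioo (t - ε) (t + ε), ∀ s' ∈ Ioo (t - ε) (t + ε),
      ddist (c s) (c s') = |s - s'|

/-- `η` is the systole of the double of `core M`: the length of a shortest closed geodesic. -/
def IsSystoleOfDouble {d : ℕ} (Γ : Subgroup (G d)) (η : ℝ) : Prop :=
  IsLeast {ℓ | HasClosedGeodesic Γ ℓ} η

/-! ### Horospherical subgroups, one-parameter subgroups and thick sets -/

/-- The nilpotent matrix `u⁻(x)`. -/
def uMinus {d : ℕ} (x : Fin (d - 1) → ℝ) : Matrix (Idx d) (Idx d) ℝ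
  | Sum.inl _, Sum.inr (Sum.inl j) => x j
  | Sum.inr (Sum.inl i), Sum.inr (Sum.inr _) => -x i
  | _, _ => 0

/-- The nilpotent matrix `u⁺(x)`. -/
def uPlus {d : ℕ} (x : Fin (d - 1) → ℝ) : Matrix (Idx d) (Idx d) ℝ
  | Sum.inr (Sum.inl i), Sum.inl _ => x i
  | Sum.inr (Sum.inr _), Sum.inr (Sum.inl j) => -x j
  | _, _ => 0

/-- The contracting horospherical group `N⁻ = {exp u⁻(x)}`, as a subset of `G`. -/
def NMinus (d : ℕ) : Set (G d) := {g | ∃ x, g.mat = NormedSpace.exp (uMinus x)}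

/-- The expanding horospherical group `N⁺ = {exp u⁺(x)}`, as a subset of `G`. -/
def NPlus (d : ℕ) : Set (G d) := {g | ∃ x, g.mat = NormedSpace.exp (uPlus x)}

/-- `u` is a one-parameter subgroup of `G`: a continuous homomorphism from `(ℝ, +)`. -/
def IsOneParameterSubgroup {d : ℕ} (u : ℝ → G d) : Prop :=
  Continuous u ∧ ∀ s t, u (s + t) = u s * u t

/-- The return times `{t ∈ ℝ | y u_t ∈ RF M}`. -/
def returnTimes {d : ℕ} {Γ : Subgroup (G d)} (u : ℝ → G d) (y : FrameBundle Γ) : Set ℝ :=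
  {t | rightMul y (u t) ∈ RF Γ}

/-- `T` is locally `k`-thick at `t`: `T ∩ (t ± [r, k r]) ≠ ∅` for every `r > 0`. -/
def LocallyThickAt (k : ℝ) (T : Set ℝ) (t : ℝ) : Prop :=
  ∀ r > 0, (T ∩ (Icc (t - k * r) (t - r) ∪ Icc (t + r) (t + k * r))).Nonempty

/-- `T` is globally `k`-thick: closed, nonempty, and locally `k`-thick at each of its points. -/
def GloballyThick (k : ℝ) (T : Set ℝ) : Prop :=
  IsClosed T ∧ T.Nonempty ∧ ∀ t ∈ T, LocallyThickAt k T t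

end FuchsianEnds

end

noncomputable section

namespace FuchsianEnds

/-! ### Linear algebra of the form `Q` -/

section LinearAlgebra

variable {d : ℕ}

/-! Suppose that `y u_t` lies in RF M but that the orbit avoids RF M for all times at distance
between r and k r from t. A one-parameter subgroup of a horospherical group fixes one end point `a`
of the frame and moves the other one, `b`, along `b + s w + s² Q(w)/2 a`. So the arcs s ∈ [r, k r]
and s ∈ [-k r, -r] of this curve at infinity avoid Λ, and by connectedness each lies in a single
ball of the complement. The two balls are distinct: `a` and `b` are in Λ, so no half-space bounding
a ball can contain the curve at both s = r and s = -r. Let `n`, `m` be their unit spacelike normals.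

The argument compares two estimates of the product of `n` and `m`. Geometrically, the closures of
the balls are disjoint, so their hyperplanes are ultraparallel with `-form n m = cosh D`, D being
the length of the common perpendicular (`form_lt_neg_one_of_disjoint`, `exists_perpendicular`). Both
hyperplanes bound hull(Λ), and the perpendicular, run through both copies of the core, closes up to
a geodesic of length 2 D in the double (`exists_hasClosedGeodesic`). Hence `cosh (η / 2) ≤ -form n
m` for the systole η.

Algebraically, `s ↦ form (horocycle a b w s) n` is a quadratic polynomial with nonpositive constant
and leading coefficients, and it is positive at r and at k r; for large k these coefficients must
have a small product. Decomposing `n` and `n + m` along `a`, `b`, `w` then gives `-form n m ≤ 1 + 8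
/ (k - 4)` (`neg_form_le`). If k is so large that the right side is below `cosh (η / 2)`, the two
estimates contradict each other. Only η enters the choice of k. -/

lemma form_comm (v w : Vec d) : form v w = form w v := by
  simp only [form, mul_comm]
  ring

lemma form_add_left (u v w : Vec d) : form (u + v) w = form u w + form v w := by
  simp only [form, Pi.add_apply, add_mul, Finset.sum_add_distrib]
  ring

lemma form_smul_left (a : ℝ) (v w : Vec d) : form (a • v) w = a * form v w := by
  simp only [form, Pi.smul_apply, smul_eq_mul, mul_add, Finset.mul_sum, mul_assoc]

lemma form_add_right (u v w : Vec d) : form u (v + w) = form u v + form u w := by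
  rw [form_comm, form_add_left, form_comm v, form_comm w]

lemma form_smul_right (a : ℝ) (v w : Vec d) : form v (a • w) = a * form v w := by
  rw [form_comm, form_smul_left, form_comm w]

lemma form_neg_left (v w : Vec d) : form (-v) w = -form v w := by
  rw [← neg_one_smul ℝ v, form_smul_left]; ring

lemma form_neg_right (v w : Vec d) : form v (-w) = -form v w := by
  rw [form_comm, form_neg_left, form_comm]

lemma form_sub_left (u v w : Vec d) : form (u - v) w = form u w - form v w := by
  rw [sub_eq_add_neg, form_add_left, form_neg_left]; ring

lemma form_sub_right (u v w : Vec d) : form u (v - w) = form u v - form u w := by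
  rw [sub_eq_add_neg, form_add_right, form_neg_right]; ring

lemma form_zero_left (w : Vec d) : form 0 w = 0 := by simp [form]

lemma continuous_form {X : Type*} [TopologicalSpace X] {f g : X → Vec d} (hf : Continuous f)
    (hg : Continuous g) : Continuous fun x => form (f x) (g x) := by
  have hf' := fun i => (continuous_apply i).comp hf
  have hg' := fun i => (continuous_apply i).comp hg
  exact (((hf' _).mul (hg' _)).add ((hf' _).mul (hg' _))).add
    (continuous_finsetSum _ fun i _ => (hf' _).mul (hg' _))

lemma ht_add (v w : Vec d) : ht (v + w) = ht v + ht w := by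
  simp only [ht, Pi.add_apply]; ring

lemma ht_smul (a : ℝ) (v : Vec d) : ht (a • v) = a * ht v := by
  simp only [ht, Pi.smul_apply, smul_eq_mul]; ring

lemma ht_neg (v : Vec d) : ht (-v) = -ht v := by
  simp only [ht, Pi.neg_apply]; ring

lemma continuous_ht : Continuous (ht : Vec d → ℝ) :=
  (continuous_apply _).sub (continuous_apply _)

/-- The positive semidefinite part of the form, `form v w = spatial v w - ht v * ht w / 2`. -/
def spatial (v w : Vec d) : ℝ :=
  (v (fstI d) + v (lstI d)) * (w (fstI d) + w (lstI d)) / 2 +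
    ∑ i : Fin (d - 1), v (midI i) * w (midI i)

lemma form_eq_spatial (v w : Vec d) : form v w = spatial v w - ht v * ht w / 2 := by
  simp only [form, spatial, ht]; ring

lemma spatial_self_nonneg (v : Vec d) : 0 ≤ spatial v v := by
  have h1 : 0 ≤ ∑ i : Fin (d - 1), v (midI i) * v (midI i) :=
    Finset.sum_nonneg fun i _ => mul_self_nonneg _
  have h2 := mul_self_nonneg (v (fstI d) + v (lstI d))
  unfold spatial; linarith

/-- Cauchy–Schwarz for a positive semidefinite form, from the discriminant of `t ↦ spatial (v + t •
w) (v + t • w)`. -/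
lemma spatial_sq_le (v w : Vec d) : spatial v w ^ 2 ≤ spatial v v * spatial w w := by
  have key : ∀ t : ℝ, 0 ≤ spatial w w * (t * t) + 2 * spatial v w * t + spatial v v := by
    intro t
    have h := spatial_self_nonneg (v + t • w)
    have e : spatial (v + t • w) (v + t • w) =
        spatial w w * (t * t) + 2 * spatial v w * t + spatial v v := by
      have : ∑ i : Fin (d - 1), (v (midI i) + t * w (midI i)) * (v (midI i) + t * w (midI i)) =
          (∑ i : Fin (d - 1), w (midI i) * w (midI i)) * (t * t) +
          2 * (∑ i : Fin (d - 1), v (midI i) * w (midI i)) * t +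
          ∑ i : Fin (d - 1), v (midI i) * v (midI i) := by
        simp only [Finset.mul_sum, Finset.sum_mul, ← Finset.sum_add_distrib]
        exact Finset.sum_congr rfl fun i _ => by ring
      simp only [spatial, Pi.add_apply, Pi.smul_apply, smul_eq_mul, this]
      ring
    linarith
  have := discrim_le_zero key
  unfold discrim at this
  nlinarith

lemma eq_zero_of_spatial_of_ht {v : Vec d} (h : spatial v v ≤ 0) (h0 : ht v = 0) : v = 0 := by
  have h1 : ∀ i ∈ Finset.univ, 0 ≤ v (midI i) * v (midI (d := d) i) :=
    fun i _ => mul_self_nonneg _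
  have h2 := mul_self_nonneg (v (fstI d) + v (lstI d))
  have h3 := Finset.sum_nonneg h1
  unfold spatial at h
  have h4 : ∑ i : Fin (d - 1), v (midI i) * v (midI i) = 0 := by linarith
  have h5 : v (fstI d) + v (lstI d) = 0 := mul_self_eq_zero.mp (by linarith)
  rw [Finset.sum_eq_zero_iff_of_nonneg h1] at h4
  unfold ht at h0
  funext i
  rcases i with ⟨⟩ | i | ⟨⟩
  · exact show v (fstI d) = 0 by linarith
  · exact mul_self_eq_zero.mp (h4 i (Finset.mem_univ _))
  · exact show v (lstI d) = 0 by linarith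

/-- A vector `v ≠ 0` with `Q(v) ≤ 0` has nonzero height. -/
lemma eq_zero_of_ht_eq_zero {v : Vec d} (h : form v v ≤ 0) (h0 : ht v = 0) : v = 0 := by
  refine eq_zero_of_spatial_of_ht ?_ h0
  rw [form_eq_spatial, h0] at h
  linarith

/-- The form is positive definite on the orthogonal complement of a timelike vector. -/
lemma form_self_pos_of_orthogonal {y w : Vec d} (hy : form y y < 0) (hw : form w y = 0)
    (h0 : w ≠ 0) : 0 < form w w := by
  by_contra! hn
  have hcs := spatial_sq_le w y
  have e1 := form_eq_spatial w w
  have e2 := form_eq_spatial w y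
  have e3 := form_eq_spatial y y
  have p1 := spatial_self_nonneg w
  have p2 := spatial_self_nonneg y
  have hw0 : ht w ≠ 0 := fun h => h0 (eq_zero_of_ht_eq_zero hn h)
  have hs : spatial w y = ht w * ht y / 2 := by linarith
  rw [hs] at hcs
  have h1 : spatial w w * spatial y y ≤ (ht w * ht w / 2) * spatial y y :=
    mul_le_mul_of_nonneg_right (by linarith) p2
  have h2 : (ht w * ht w / 2) * spatial y y < (ht w * ht w / 2) * (ht y * ht y / 2) := by
    refine mul_lt_mul_of_pos_left (by linarith) ?_
    have := mul_self_pos.mpr hw0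
    linarith
  nlinarith

lemma form_self_nonneg_of_orthogonal {y w : Vec d} (hy : form y y < 0) (hw : form w y = 0) :
    0 ≤ form w w := by
  rcases eq_or_ne w 0 with rfl | h
  · simp [form_zero_left]
  · exact (form_self_pos_of_orthogonal hy hw h).le

lemma form_sq_le_of_orthogonal {y v w : Vec d} (hy : form y y < 0) (hv : form v y = 0)
    (hw : form w y = 0) : form v w ^ 2 ≤ form v v * form w w := by
  have key : ∀ t : ℝ, 0 ≤ form w w * (t * t) + 2 * form v w * t + form v v := by
    intro t
    have h := form_self_nonneg_of_orthogonal (w := v + t • w) hy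
      (by rw [form_add_left, form_smul_left, hv, hw]; ring)
    rw [form_add_left, form_add_right, form_add_right, form_smul_left, form_smul_right,
      form_smul_left, form_smul_right, form_comm w v] at h
    linarith
  have := discrim_le_zero key
  unfold discrim at this
  nlinarith

/-- Causal vectors: the product with a timelike vector has the sign opposite to the heights. -/
lemma form_mul_ht_neg {v y : Vec d} (hv : form v v ≤ 0) (h0 : ht v ≠ 0) (hy : form y y < 0) :
    form v y * (ht v * ht y) < 0 := by
  have hcs := spatial_sq_le v y
  have e1 := form_eq_spatial v v
  have e2 := form_eq_spatial v y
  have e3 := form_eq_spatial y y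
  have p2 := spatial_self_nonneg y
  have hv2 := mul_self_pos.mpr h0
  have hy2 : 0 < ht y * ht y := by linarith
  have h1 : spatial v v * spatial y y ≤ (ht v * ht v / 2) * spatial y y :=
    mul_le_mul_of_nonneg_right (by linarith) p2
  have h2 : (ht v * ht v / 2) * spatial y y < (ht v * ht v / 2) * (ht y * ht y / 2) :=
    mul_lt_mul_of_pos_left (by linarith) (by linarith)
  -- Cauchy–Schwarz is strict here, so the height term outweighs the spatial term and decides the
  -- sign of `form v y`.
  have h3 : spatial v y ^ 2 < (ht v * ht y / 2) ^ 2 := by nlinarith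
  have h4 : |spatial v y| < |ht v * ht y / 2| := sq_lt_sq.mp h3
  have h5 : 0 < (ht v * ht y / 2) ^ 2 := lt_of_le_of_lt (sq_nonneg _) h3
  have h6 : spatial v y * (ht v * ht y / 2) ≤ |spatial v y| * |ht v * ht y / 2| := by
    rw [← abs_mul]; exact le_abs_self _
  have h7 : |spatial v y| * |ht v * ht y / 2| < |ht v * ht y / 2| * |ht v * ht y / 2| :=
    mul_lt_mul_of_pos_right h4 (lt_of_le_of_lt (abs_nonneg _) h4)
  rw [abs_mul_abs_self] at h7
  rw [e2]
  nlinarith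

lemma form_neg_of_ht_pos {v y : Vec d} (hv : form v v ≤ 0) (h0 : 0 < ht v) (hy : form y y < 0)
    (hy0 : 0 < ht y) : form v y < 0 := by
  have h := form_mul_ht_neg hv h0.ne' hy
  exact neg_of_mul_neg_left h (mul_pos h0 hy0).le

/-- One test against a future timelike vector decides the time orientation of a causal vector. This
is how the vectors constructed below are shown to have positive height. -/
lemma ht_pos_of_form_neg {v y : Vec d} (hv : form v v ≤ 0) (hy : form y y < 0)
    (hy0 : 0 < ht y) (h : form v y < 0) : 0 < ht v := by
  have h0 : ht v ≠ 0 := by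
    intro h1
    rw [eq_zero_of_ht_eq_zero hv h1, form_zero_left] at h
    exact lt_irrefl _ h
  have h1 := form_mul_ht_neg hv h0 hy
  have h2 : 0 < ht v * ht y := by
    by_contra! h3
    have := mul_nonneg_of_nonpos_of_nonpos h.le h3
    linarith
  exact pos_of_mul_pos_left h2 hy0.le

lemma hyp_timelike (x : Hyp d) : form x.1 x.1 < 0 := by rw [x.2.1]; norm_num

/-- In dimension at least two there is a unit vector orthogonal to a timelike vector and to
another given vector. -/
lemma exists_unit_orthogonal (hd : 2 ≤ d) {y : Vec d} (hy : form y y < 0) (n : Vec d) :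
    ∃ v, form v v = 1 ∧ form v y = 0 ∧ form v n = 0 := by
  let F : Vec d →ₗ[ℝ] (Fin 2 → ℝ) :=
    { toFun := fun v => ![form v y, form v n]
      map_add' := fun u v => by
        funext i; fin_cases i <;> simp [form_add_left]
      map_smul' := fun a v => by
        funext i; fin_cases i <;> simp [form_smul_left] }
  have hlt : Module.finrank ℝ (Fin 2 → ℝ) < Module.finrank ℝ (Vec d) := by
    simp only [Module.finrank_fintype_fun_eq_card, Fintype.card_fin, Fintype.card_sum,
      Fintype.card_unit]
    omega
  obtain ⟨v, hv, hv0⟩ := (Submodule.ne_bot_iff _).mp (LinearMap.ker_ne_bot_of_finrank_lt hlt)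
  have h1 : form v y = 0 := congrFun (show F v = 0 from hv) 0
  have h2 : form v n = 0 := congrFun (show F v = 0 from hv) 1
  have h3 := form_self_pos_of_orthogonal hy h1 hv0
  refine ⟨(√(form v v))⁻¹ • v, ?_, ?_, ?_⟩
  · rw [form_smul_left, form_smul_right, ← mul_assoc, ← mul_inv, Real.mul_self_sqrt h3.le,
      inv_mul_cancel₀ h3.ne']
  · rw [form_smul_left, h1, mul_zero]
  · rw [form_smul_left, h2, mul_zero]

/-- A future timelike vector, normalized. -/
def normalize (v : Vec d) (h : form v v < 0) (h0 : 0 < ht v) : Hyp d :=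
  ⟨(√(-form v v))⁻¹ • v, by
    rw [form_smul_left, form_smul_right, ← mul_assoc, ← mul_inv,
      Real.mul_self_sqrt (by linarith)]
    rw [inv_neg, neg_mul, inv_mul_cancel₀ h.ne], by
    rw [ht_smul]
    exact mul_pos (inv_pos.mpr (Real.sqrt_pos.mpr (by linarith))) h0⟩

/-! ### Hyperbolic distance -/

/-- The component of `x` orthogonal to `y` has nonnegative norm, so the square of the product is at
least 1; the product is negative because both points are on the same sheet. -/
lemma one_le_neg_form (x y : Hyp d) : 1 ≤ -form x.1 y.1 := by
  have h1 := form_neg_of_ht_pos (hyp_timelike x).le x.2.2 (hyp_timelike y) y.2.2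
  have h2 := form_self_nonneg_of_orthogonal (w := x.1 + form x.1 y.1 • y.1) (hyp_timelike y)
    (by rw [form_add_left, form_smul_left, y.2.1]; ring)
  simp only [form_add_left, form_add_right, form_smul_left, form_smul_right, y.2.1, x.2.1,
    form_comm y.1 x.1] at h2
  nlinarith

lemma cosh_hdist (x y : Hyp d) : Real.cosh (hdist x y) = -form x.1 y.1 :=
  Real.cosh_arcosh (one_le_neg_form x y)

lemma hdist_nonneg (x y : Hyp d) : 0 ≤ hdist x y := Real.arcosh_nonneg (one_le_neg_form x y)

lemma hdist_comm (x y : Hyp d) : hdist x y = hdist y x := by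
  unfold hdist; rw [form_comm]

lemma hdist_le_iff {x y : Hyp d} {r : ℝ} (hr : 0 ≤ r) :
    hdist x y ≤ r ↔ -form x.1 y.1 ≤ Real.cosh r := by
  rw [← cosh_hdist, Real.cosh_le_cosh, abs_of_nonneg (hdist_nonneg x y), abs_of_nonneg hr]

lemma le_hdist_iff {x y : Hyp d} {r : ℝ} (hr : 0 ≤ r) :
    r ≤ hdist x y ↔ Real.cosh r ≤ -form x.1 y.1 := by
  rw [← cosh_hdist, Real.cosh_le_cosh, abs_of_nonneg (hdist_nonneg x y), abs_of_nonneg hr]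

lemma hdist_eq_of_form {x y : Hyp d} {r : ℝ} (h : -form x.1 y.1 = Real.cosh r) :
    hdist x y = |r| := by
  unfold hdist
  rw [h, ← Real.cosh_abs, Real.arcosh_cosh (abs_nonneg r)]

lemma hdist_self (x : Hyp d) : hdist x x = 0 := by
  rw [hdist_eq_of_form (r := 0), abs_zero]
  rw [x.2.1, Real.cosh_zero]; norm_num

lemma eq_of_hdist_eq_zero {x y : Hyp d} (h : hdist x y = 0) : x = y := by
  have h1 := cosh_hdist x y
  rw [h, Real.cosh_zero] at h1
  by_contra hne
  have h2 : form (x.1 - y.1) (x.1 - y.1) = 0 := by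
    simp only [form_sub_left, form_sub_right, x.2.1, y.2.1, form_comm y.1 x.1]
    linarith
  have h3 : form (x.1 - y.1) y.1 = 0 := by
    rw [form_sub_left, y.2.1]; linarith
  have := form_self_pos_of_orthogonal (hyp_timelike y) h3
    (fun h => hne (Subtype.ext (sub_eq_zero.mp h)))
  linarith

/-- By the addition formula for cosh this is Cauchy–Schwarz for the components of `x` and `z`
orthogonal to `y`, whose norms are the sinh of the two distances. -/
lemma hdist_triangle (x y z : Hyp d) : hdist x z ≤ hdist x y + hdist y z := by
  rw [hdist_le_iff (add_nonneg (hdist_nonneg _ _) (hdist_nonneg _ _)), Real.cosh_add,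
    cosh_hdist, cosh_hdist]
  have h1 : form (x.1 + form x.1 y.1 • y.1) y.1 = 0 := by
    rw [form_add_left, form_smul_left, y.2.1]; ring
  have h2 : form (z.1 + form z.1 y.1 • y.1) y.1 = 0 := by
    rw [form_add_left, form_smul_left, y.2.1]; ring
  have h := form_sq_le_of_orthogonal (hyp_timelike y) h1 h2
  simp only [form_add_left, form_add_right, form_smul_left, form_smul_right, y.2.1, x.2.1,
    z.2.1, form_comm y.1] at h
  have s1 := Real.cosh_sq (hdist x y)
  have s2 := Real.cosh_sq (hdist y z)
  rw [cosh_hdist] at s1 s2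
  have p1 := Real.sinh_nonneg_iff.mpr (hdist_nonneg x y)
  have p2 := Real.sinh_nonneg_iff.mpr (hdist_nonneg y z)
  have h3 : (form x.1 z.1 + form x.1 y.1 * form z.1 y.1) ^ 2 ≤
      (Real.sinh (hdist x y) * Real.sinh (hdist y z)) ^ 2 := by
    rw [mul_pow, ← sub_eq_of_eq_add s1, ← sub_eq_of_eq_add s2, form_comm y.1 z.1]
    calc _ = _ := by ring
      _ ≤ _ := h
      _ = _ := by ring
  have h4 := (abs_le_of_sq_le_sq' h3 (mul_nonneg p1 p2)).1
  rw [form_comm y.1 z.1]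
  linarith

lemma hdist_smul (g : G d) (x y : Hyp d) : hdist (g • x) (g • y) = hdist x y := by
  unfold hdist
  rw [show form (g • x).1 (g • y).1 = form x.1 y.1 from form_mat g x.1 y.1]

/-- The distance to a point of a hyperplane bounds the distance to the hyperplane. -/
lemma abs_form_le_sinh {p : Hyp d} {n : Vec d} (hn : form n n = 1) (hp : form p.1 n = 0)
    (z : Hyp d) : |form z.1 n| ≤ Real.sinh (hdist p z) := by
  have h1 : form (z.1 + form z.1 p.1 • p.1) p.1 = 0 := by
    rw [form_add_left, form_smul_left, p.2.1]; ring
  have h := form_sq_le_of_orthogonal (hyp_timelike p) h1 (by rw [form_comm]; exact hp)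
  simp only [form_add_left, form_add_right, form_smul_left, form_smul_right, p.2.1,
    z.2.1, form_comm p.1 z.1, hn, hp] at h
  have s1 := Real.cosh_sq (hdist p z)
  rw [cosh_hdist, form_comm] at s1
  exact abs_le_of_sq_le_sq (by nlinarith) (Real.sinh_nonneg_iff.mpr (hdist_nonneg p z))

end LinearAlgebra

/-! ### The limit set and its convex hull -/

section LimitSet

variable {d : ℕ}

lemma mulVec_add' (g : G d) (v w : Vec d) :
    g.mat.mulVec (v + w) = g.mat.mulVec v + g.mat.mulVec w := Matrix.mulVec_add _ _ _

lemma mulVec_smul' (g : G d) (a : ℝ) (v : Vec d) :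
    g.mat.mulVec (a • v) = a • g.mat.mulVec v := Matrix.mulVec_smul _ _ _

lemma mat_mul (g h : G d) : (g * h).mat = g.mat * h.mat := rfl

lemma mulVec_mul (g h : G d) (v : Vec d) :
    (g * h).mat.mulVec v = g.mat.mulVec (h.mat.mulVec v) := by
  rw [mat_mul, Matrix.mulVec_mulVec]

lemma mulVec_inv_mulVec (g : G d) (v : Vec d) : g⁻¹.mat.mulVec (g.mat.mulVec v) = v := by
  rw [← mulVec_mul, inv_mul_cancel]; exact Matrix.one_mulVec v

lemma mulVec_mulVec_inv (g : G d) (v : Vec d) : g.mat.mulVec (g⁻¹.mat.mulVec v) = v := by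
  rw [← mulVec_mul, mul_inv_cancel]; exact Matrix.one_mulVec v

lemma ht_mulVec_pos (g : G d) {v : Vec d} (hv : form v v ≤ 0) (h0 : 0 < ht v) :
    0 < ht (g.mat.mulVec v) := by
  refine ht_pos_of_form_neg (y := (g • o d).1) ?_ (hyp_timelike _) (g • o d).2.2 ?_
  · rw [form_mat]; exact hv
  · rw [show form (g.mat.mulVec v) (g • o d).1 = form v (o d).1 from form_mat g v _]
    exact form_neg_of_ht_pos hv h0 (hyp_timelike _) (o d).2.2

lemma ht_klein {v : Vec d} (h : ht v ≠ 0) : ht (klein v) = 1 := by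
  rw [klein, ht_smul, inv_mul_cancel₀ h]

lemma klein_smul {a : ℝ} (ha : a ≠ 0) (v : Vec d) : klein (a • v) = klein v := by
  rw [klein, klein, ht_smul, smul_smul, mul_inv]
  congr 1
  field_simp

lemma klein_eq_self {v : Vec d} (h : ht v = 1) : klein v = v := by
  rw [klein, h, inv_one, one_smul]

lemma smul_klein {v : Vec d} (h : ht v ≠ 0) : ht v • klein v = v := by
  rw [klein, smul_smul, mul_inv_cancel₀ h, one_smul]

lemma form_klein_left (v w : Vec d) : form (klein v) w = (ht v)⁻¹ * form v w :=
  form_smul_left _ _ _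

lemma form_klein_self (v : Vec d) : form (klein v) (klein v) = (ht v)⁻¹ * (ht v)⁻¹ * form v v := by
  rw [klein, form_smul_left, form_smul_right, mul_assoc]

lemma klein_mulVec_klein (g : G d) {v : Vec d} (h : ht v ≠ 0) :
    klein (g.mat.mulVec (klein v)) = klein (g.mat.mulVec v) := by
  rw [klein.eq_1 v, mulVec_smul', klein_smul (inv_ne_zero h)]

lemma klein_mem_sphereInf {v : Vec d} (hv : form v v = 0) (h0 : ht v ≠ 0) :
    klein v ∈ sphereInf d :=
  ⟨by rw [form_klein_self, hv, mul_zero], ht_klein h0⟩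

lemma continuousAt_klein {v : Vec d} (h : ht v ≠ 0) : ContinuousAt klein v :=
  (continuous_ht.continuousAt.inv₀ h).smul continuousAt_id

lemma continuous_mulVec (g : G d) : Continuous fun v => g.mat.mulVec v :=
  continuous_const.matrix_mulVec continuous_id

lemma isClosed_sphereInf : IsClosed (sphereInf d) :=
  (isClosed_eq (continuous_form continuous_id continuous_id) continuous_const).inter
    (isClosed_eq continuous_ht continuous_const)

lemma klein_hyp_ne (z : Hyp d) {ξ : Vec d} (hξ : ξ ∈ sphereInf d) : klein z.1 ≠ ξ := by
  rintro rfl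
  have h := hξ.1
  rw [form_klein_self, z.2.1] at h
  have := mul_self_pos.mpr (inv_ne_zero z.2.2.ne')
  linarith

variable {Γ : Subgroup (G d)}

lemma subgroup_smul_val (γ : Γ) (x : Hyp d) : (γ • x).1 = (γ : G d).mat.mulVec x.1 := rfl

lemma isClosed_limitSet (Γ : Subgroup (G d)) : IsClosed (limitSet Γ) :=
  isClosed_sphereInf.inter (isClosed_derivedSet _)

/-- The projective action of `γ` is continuous at `ξ` and permutes the orbit of `o`, hence its
accumulation points. Orbit points are interior to the ball, so their images never coincide with the
limit point itself. -/
lemma klein_mulVec_mem_limitSet {γ : G d} (hγ : γ ∈ Γ) {ξ : Vec d} (h : ξ ∈ limitSet Γ) :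
    klein (γ.mat.mulVec ξ) ∈ limitSet Γ := by
  have hpos : 0 < ht (γ.mat.mulVec ξ) :=
    ht_mulVec_pos γ h.1.1.le (by rw [h.1.2]; norm_num)
  have hnull : form (γ.mat.mulVec ξ) (γ.mat.mulVec ξ) = 0 := by rw [form_mat]; exact h.1.1
  refine ⟨klein_mem_sphereInf hnull hpos.ne', ?_⟩
  have hT : Tendsto (fun v => klein (γ.mat.mulVec v)) (𝓝 ξ) (𝓝 (klein (γ.mat.mulVec ξ))) :=
    (continuousAt_klein hpos.ne').comp_of_eq (continuous_mulVec γ).continuousAt rfl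
  have h2 := accPt_iff_frequently.mp h.2
  refine accPt_iff_frequently.mpr (hT.frequently (h2.mono ?_))
  rintro y ⟨-, γ', rfl⟩
  have e : klein (γ.mat.mulVec (klein (γ' • o d).1)) =
      klein (((⟨γ, hγ⟩ : Γ) * γ') • o d).1 := by
    rw [klein_mulVec_klein γ (γ' • o d).2.2.ne', subgroup_smul_val, subgroup_smul_val,
      Subgroup.coe_mul, mulVec_mul]
  refine ⟨?_, ⟨(⟨γ, hγ⟩ : Γ) * γ', e.symm⟩⟩
  rw [e]
  exact klein_hyp_ne _ (klein_mem_sphereInf hnull hpos.ne')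

lemma klein_mulVec_mem_limitSet_iff {γ : G d} (hγ : γ ∈ Γ) {v : Vec d} (hv : form v v = 0)
    (h0 : ht v ≠ 0) : klein (γ.mat.mulVec v) ∈ limitSet Γ ↔ klein v ∈ limitSet Γ := by
  constructor
  · intro h
    have h1 := klein_mulVec_mem_limitSet (Γ.inv_mem hγ) h
    have hne : ht (γ.mat.mulVec v) ≠ 0 := by
      intro h2
      have h3 := eq_zero_of_ht_eq_zero (v := γ.mat.mulVec v) (by rw [form_mat, hv]) h2
      have h4 := mulVec_inv_mulVec γ v
      rw [h3, Matrix.mulVec_zero] at h4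
      rw [← h4] at h0
      simp [ht] at h0
    rwa [klein_mulVec_klein _ hne, mulVec_inv_mulVec] at h1
  · intro h
    have h1 := klein_mulVec_mem_limitSet hγ h
    rwa [klein_mulVec_klein _ h0] at h1

/-- The positive cone over the convex hull of the limit set. -/
def hullCone (Γ : Subgroup (G d)) : Set (Vec d) :=
  {v | 0 < ht v ∧ klein v ∈ convexHull ℝ (limitSet Γ)}

lemma hullCone_smul {v : Vec d} (hv : v ∈ hullCone Γ) {a : ℝ} (ha : 0 < a) :
    a • v ∈ hullCone Γ :=
  ⟨by rw [ht_smul]; exact mul_pos ha hv.1, by rw [klein_smul ha.ne']; exact hv.2⟩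

/-- In the affine chart, `v + w` is the convex combination of `klein v` and `klein w` weighted by
the heights. -/
lemma hullCone_add {v w : Vec d} (hv : v ∈ hullCone Γ) (hw : w ∈ hullCone Γ) :
    v + w ∈ hullCone Γ := by
  have hv0 := hv.1
  have hw0 := hw.1
  refine ⟨by rw [ht_add]; linarith, ?_⟩
  have e : klein (v + w) = (ht v / (ht v + ht w)) • klein v + (ht w / (ht v + ht w)) • klein w := by
    rw [klein, klein, klein, ht_add, smul_smul, smul_smul, smul_add]
    congr 2 <;> field_simp
  rw [e]
  exact convex_convexHull ℝ _ hv.2 hw.2 (by positivity) (by positivity) (by field_simp)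

lemma mem_hullCone_of_klein {v : Vec d} (h0 : 0 < ht v) (h : klein v ∈ limitSet Γ) :
    v ∈ hullCone Γ := ⟨h0, subset_convexHull ℝ _ h⟩

lemma mem_hull_iff {x : Hyp d} : x ∈ hull Γ ↔ x.1 ∈ hullCone Γ :=
  ⟨fun h => ⟨x.2.2, h⟩, fun h => h.2⟩

/-- `Γ` acts on the affine chart only projectively, but linearly on the cone. Thus the preimage of
the cone under `γ` meets the chart in a convex set that contains `Λ`. -/
lemma mulVec_mem_hullCone {γ : G d} (hγ : γ ∈ Γ) {v : Vec d} (hv : v ∈ hullCone Γ) :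
    γ.mat.mulVec v ∈ hullCone Γ := by
  have hK : convexHull ℝ (limitSet Γ) ⊆ {ξ | γ.mat.mulVec ξ ∈ hullCone Γ} := by
    refine convexHull_min ?_ (convex_iff_forall_pos.mpr ?_)
    · intro ξ h
      exact mem_hullCone_of_klein (ht_mulVec_pos γ h.1.1.le (by rw [h.1.2]; norm_num))
        (klein_mulVec_mem_limitSet hγ h)
    · intro ξ hξ η hη a b ha hb _
      have : γ.mat.mulVec (a • ξ + b • η) = a • γ.mat.mulVec ξ + b • γ.mat.mulVec η := by
        rw [mulVec_add', mulVec_smul', mulVec_smul']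
      rw [mem_ofPred_eq, this]
      exact hullCone_add (hullCone_smul hξ ha) (hullCone_smul hη hb)
  have h := hullCone_smul (hK hv.2) hv.1
  rwa [← mulVec_smul', smul_klein hv.1.ne'] at h

lemma smul_mem_hull (γ : Γ) {x : Hyp d} (hx : x ∈ hull Γ) : γ • x ∈ hull Γ :=
  mem_hull_iff.mpr (mulVec_mem_hullCone γ.2 (mem_hull_iff.mp hx))

/-- Lower half-spaces containing the limit set contain its hull. -/
lemma form_nonpos_of_mem_hullCone {n : Vec d} (hn : ∀ ξ ∈ limitSet Γ, form ξ n ≤ 0) {v : Vec d}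
    (hv : v ∈ hullCone Γ) : form v n ≤ 0 := by
  have hK : convexHull ℝ (limitSet Γ) ⊆ {ξ | form ξ n ≤ 0} := by
    refine convexHull_min hn ?_
    intro ξ hξ η hη a b ha hb _
    simp only [mem_ofPred_eq] at hξ hη ⊢
    rw [form_add_left, form_smul_left, form_smul_left]
    nlinarith [mul_nonneg ha (neg_nonneg.mpr hξ), mul_nonneg hb (neg_nonneg.mpr hη)]
  have h : form (klein v) n ≤ 0 := hK hv.2
  rw [← smul_klein hv.1.ne', form_smul_left]
  exact mul_nonpos_of_nonneg_of_nonpos hv.1.le h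

end LimitSet

/-! ### Round balls and their boundary hyperplanes -/

section Balls

variable {d : ℕ}

/-- Orthogonal projection of a future timelike vector along a spacelike vector. -/
lemma exists_timelike_orthogonal {y n : Vec d} (hy : form y y < 0) (hy0 : 0 < ht y)
    (hn : 0 < form n n) : ∃ y', form y' y' < 0 ∧ 0 < ht y' ∧ form y' n = 0 ∧
      ∀ z, form n z = 0 → form y' z = form y z := by
  have h1 : form (y - (form y n / form n n) • n) (y - (form y n / form n n) • n) =
      form y y - form y n ^ 2 / form n n := by
    simp only [form_sub_left, form_sub_right, form_smul_left, form_smul_right, form_comm n y]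
    field_simp
    ring
  have h2 : 0 ≤ form y n ^ 2 / form n n := by positivity
  have h3 : form (y - (form y n / form n n) • n) y = form y y - form y n ^ 2 / form n n := by
    simp only [form_sub_left, form_smul_left, form_comm n y]
    field_simp
  refine ⟨y - (form y n / form n n) • n, by linarith, ?_, ?_, ?_⟩
  · exact ht_pos_of_form_neg (by linarith) hy hy0 (by linarith)
  · rw [form_sub_left, form_smul_left]
    field_simp
    ring
  · intro z hz
    rw [form_sub_left, form_smul_left, hz]
    ring

lemma exists_hyp_orthogonal {n : Vec d} (hn : form n n = 1) : ∃ y : Hyp d, form y.1 n = 0 := by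
  obtain ⟨y, h1, h2, h3, -⟩ := exists_timelike_orthogonal (hyp_timelike (o d)) (o d).2.2
    (n := n) (by rw [hn]; norm_num)
  exact ⟨normalize y h1 h2, by rw [normalize, form_smul_left, h3, mul_zero]⟩

lemma mem_closure_roundBall {n : Vec d} (hn : form n n = 1) {ξ : Vec d} (hξ : ξ ∈ sphereInf d)
    (h : 0 ≤ form ξ n) : ξ ∈ closure (roundBall n) := by
  rcases h.lt_or_eq with h | h
  · exact subset_closure ⟨hξ, h⟩
  obtain ⟨y, hy⟩ := exists_hyp_orthogonal hn
  have ha : form ξ y.1 < 0 := form_neg_of_ht_pos hξ.1.le (by rw [hξ.2]; norm_num)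
    (hyp_timelike y) y.2.2
  -- The image of `ξ` under the boost of parameter `s` in the plane of `y` and `n`, which pushes the
  -- boundary point `ξ` into the ball for `s > 0`.
  let b : ℝ → Vec d := fun s =>
    ξ + (-form ξ y.1) • ((Real.cosh s - 1) • y.1 + Real.sinh s • n)
  have hnull : ∀ s, form (b s) (b s) = 0 := by
    intro s
    simp only [b, form_add_left, form_add_right, form_smul_left, form_smul_right, hξ.1, ← h, hn,
      hy, y.2.1, form_comm y.1 ξ, form_comm n]
    have := Real.cosh_sq s
    linear_combination (form ξ y.1) ^ 2 * (-1) * this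
  have hby : ∀ s, form (b s) y.1 = form ξ y.1 * Real.cosh s := by
    intro s
    simp only [b, form_add_left, form_smul_left, form_comm n, hy, y.2.1]
    ring
  have hbn : ∀ s, form (b s) n = -form ξ y.1 * Real.sinh s := by
    intro s
    simp only [b, form_add_left, form_smul_left, hy, hn, ← h]
    ring
  have hpos : ∀ s, 0 < ht (b s) := fun s =>
    ht_pos_of_form_neg (hnull s).le (hyp_timelike y) y.2.2
      (by rw [hby]; exact mul_neg_of_neg_of_pos ha (Real.cosh_pos s))
  have hc : Continuous b := by simp only [b]; fun_prop
  have hb0 : b 0 = ξ := by simp [b]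
  have hT : Tendsto (fun s => klein (b s)) (𝓝[>] 0) (𝓝 ξ) := by
    have h1 : ContinuousAt (fun s => klein (b s)) 0 :=
      (continuousAt_klein (hpos 0).ne').comp_of_eq hc.continuousAt rfl
    have h2 := h1.tendsto
    rw [hb0, klein_eq_self hξ.2] at h2
    exact h2.mono_left nhdsWithin_le_nhds
  refine mem_closure_of_tendsto hT ?_
  filter_upwards [self_mem_nhdsWithin] with s hs
  refine ⟨klein_mem_sphereInf (hnull s) (hpos s).ne', ?_⟩
  rw [form_klein_left, hbn]
  exact mul_pos (inv_pos.mpr (hpos s))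
    (mul_pos (neg_pos.mpr ha) (Real.sinh_pos_iff.mpr hs))

/-! ### Pairs of round balls with disjoint closures -/

section Disjoint

variable {n m : Vec d} (hn : form n n = 1) (hm : form m m = 1)
  (hdis : Disjoint (closure (roundBall n)) (closure (roundBall m)))

include hn hm hdis

lemma not_nonneg_of_disjoint {v : Vec d} (hv : form v v = 0) (h0 : 0 < ht v)
    (h1 : 0 ≤ form v n) : form v m < 0 := by
  by_contra! h2
  have hs := klein_mem_sphereInf hv h0.ne'
  have hi := (inv_pos.mpr h0).le
  exact disjoint_left.mp hdis
    (mem_closure_roundBall hn hs (by rw [form_klein_left]; exact mul_nonneg hi h1))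
    (mem_closure_roundBall hm hs (by rw [form_klein_left]; exact mul_nonneg hi h2))

lemma eq_zero_of_disjoint {v : Vec d} (hv : form v v = 0) (h1 : form v n = 0)
    (h2 : form v m = 0) : v = 0 := by
  refine eq_zero_of_ht_eq_zero hv.le ?_
  rcases lt_trichotomy (ht v) 0 with h | h | h
  · have := not_nonneg_of_disjoint hn hm hdis (v := -v)
      (by rw [form_neg_left, form_neg_right, hv]; ring) (by rw [ht_neg]; linarith)
      (by rw [form_neg_left, h1, neg_zero])
    rw [form_neg_left, h2] at this
    linarith
  · exact h
  · have := not_nonneg_of_disjoint hn hm hdis hv h h1.ge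
    linarith

/-- Round balls with disjoint closures have ultraparallel boundary hyperplanes. -/
lemma form_lt_neg_one_of_disjoint (hd : 2 ≤ d) : form n m < -1 := by
  by_contra! hc
  have hmn := form_comm m n
  -- Parallel normals share their orthogonal complement, which contains the nonzero null vector `y +
  -- v`.
  have hpar : ∀ a : ℝ, m = a • n → False := by
    intro a ha
    obtain ⟨y, hy⟩ := exists_hyp_orthogonal hn
    obtain ⟨v, hv, hvy, hvn⟩ := exists_unit_orthogonal hd (hyp_timelike y) n
    have hyn : form (y.1 + v) n = 0 := by rw [form_add_left, hy, hvn, add_zero]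
    have h0 : y.1 + v = 0 := by
      refine eq_zero_of_disjoint hn hm hdis ?_ hyn (by rw [ha, form_smul_right, hyn, mul_zero])
      simp only [form_add_left, form_add_right, form_comm y.1 v, hv, hvy, y.2.1]
      norm_num
    have h1 : form (y.1 + v) v = 1 := by
      rw [form_add_left, form_comm y.1 v, hvy, hv, zero_add]
    rw [h0, form_zero_left] at h1
    norm_num at h1
  have hadd : form (n + m) (n + m) = 2 * (1 + form n m) := by
    simp only [form_add_left, form_add_right, hn, hm, hmn]; ring
  have hsub : form (n - m) (n - m) = 2 * (1 - form n m) := by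
    simp only [form_sub_left, form_sub_right, hn, hm, hmn]; ring
  have han : form (n + m) n = 1 + form n m := by rw [form_add_left, hn, hmn]
  have ham : form (n + m) m = 1 + form n m := by rw [form_add_left, hm]; ring
  have hsn : form (n - m) n = 1 - form n m := by rw [form_sub_left, hn, hmn]
  have hsm : form (n - m) m = form n m - 1 := by rw [form_sub_left, hm]
  rcases hc.eq_or_lt with hc | hc
  -- If the product is -1, the null vector `n + m` is orthogonal to both normals.
  · have := eq_zero_of_disjoint hn hm hdis (v := n + m) (by rw [hadd, ← hc]; ring)
      (by rw [han, ← hc]; ring) (by rw [ham, ← hc]; ring)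
    exact hpar (-1) (by rw [neg_one_smul]; exact eq_neg_of_add_eq_zero_right this)
  rcases lt_trichotomy (form n m) 1 with hc1 | hc1 | hc1
  -- If the product is in (-1, 1), the normals span a spacelike plane and the hyperplanes cross at a
  -- timelike `y`. Adding the right multiple of `n + m` to `y` gives a null vector in both closed
  -- half-spaces.
  · obtain ⟨y₁, hy₁, hy₁', hyn₁, -⟩ := exists_timelike_orthogonal (hyp_timelike (o d))
      (o d).2.2 (n := n) (by rw [hn]; norm_num)
    have hne : form n (m - form n m • n) = 0 := by
      rw [form_sub_right, form_smul_right, hn]; ring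
    obtain ⟨y, hy, hy', hym, hyz⟩ := exists_timelike_orthogonal hy₁ hy₁'
      (n := m - form n m • n) (by
        simp only [form_sub_left, form_sub_right, form_smul_left, form_smul_right, hn, hm, hmn]
        nlinarith)
    have hyn : form y n = 0 := by rw [hyz n (by rw [form_comm]; exact hne), hyn₁]
    rw [form_sub_right, form_smul_right, hyn] at hym
    have hym' : form y m = 0 := by linarith
    have hya : form (n + m) y = 0 := by
      rw [form_comm, form_add_right, hyn, hym', add_zero]
    set e := √(-form y y / (2 * (1 + form n m))) with he
    have he2 : e * e = -form y y / (2 * (1 + form n m)) :=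
      Real.mul_self_sqrt (div_nonneg (by linarith) (by linarith))
    have he0 : 0 ≤ e := Real.sqrt_nonneg _
    have hnn : 0 ≤ e * (1 + form n m) := mul_nonneg he0 (by linarith)
    have := not_nonneg_of_disjoint hn hm hdis (v := y + e • (n + m)) (by
        rw [form_add_left, form_add_right, form_add_right, form_smul_left, form_smul_right,
          form_smul_left, form_smul_right, form_comm y (n + m), hya, hadd, ← mul_assoc e e, he2]
        have : 1 + form n m ≠ 0 := by linarith
        field_simp
        ring)
      (by
        refine ht_pos_of_form_neg (y := y) ?_ hy hy' ?_
        · rw [form_add_left, form_add_right, form_add_right, form_smul_left, form_smul_right,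
            form_smul_left, form_smul_right, form_comm y (n + m), hya, hadd, ← mul_assoc e e, he2]
          have : 1 + form n m ≠ 0 := by linarith
          field_simp
          linarith
        · rw [form_add_left, form_smul_left, hya]; linarith)
      (by rw [form_add_left, form_smul_left, hyn, han]; linarith)
    rw [form_add_left, form_smul_left, hym', ham] at this
    linarith
  · have := eq_zero_of_disjoint hn hm hdis (v := n - m) (by rw [hsub, hc1]; ring)
      (by rw [hsn, hc1]; ring) (by rw [hsm, hc1]; ring)
    exact hpar 1 (by rw [one_smul]; exact (sub_eq_zero.mp this).symm)
  -- If the product exceeds 1, then `n - m` and `n + m` have norms `-4 A²` and `4 B²`, so `B (±(n -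
  -- m)) + A (n + m)` is null. Its products with the normals are `2 A B (B ∓ A) ≥ 0`, and the sign
  -- `ε` makes it future directed.
  · set A := √((form n m - 1) / 2)
    set B := √((form n m + 1) / 2)
    have hA : A * A = (form n m - 1) / 2 := Real.mul_self_sqrt (by linarith)
    have hB : B * B = (form n m + 1) / 2 := Real.mul_self_sqrt (by linarith)
    have hA0 : 0 ≤ A := Real.sqrt_nonneg _
    have hB0 : 0 < B := Real.sqrt_pos.mpr (by linarith)
    have hAB : A ≤ B := Real.sqrt_le_sqrt (by linarith)
    have hsa : form (n - m) (n + m) = 0 := by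
      rw [form_comm, form_sub_right, han, ham, sub_self]
    have htl : form (n - m) (n - m) < 0 := by rw [hsub]; linarith
    have key : ∀ ε : ℝ, ε * ε = 1 → 0 < ht (ε • (n - m)) → False := by
      intro ε hε h0
      have hε1 : |ε| = 1 := by
        rcases mul_self_eq_one_iff.mp hε with h | h <;> rw [h] <;> norm_num
      have hε2 := abs_le.mp hε1.le
      have hnull : form (B • (ε • (n - m)) + A • (n + m)) (B • (ε • (n - m)) + A • (n + m)) = 0 := by
        rw [form_add_left, form_add_right, form_add_right]
        simp only [form_smul_left, form_smul_right, hsa, form_comm (n + m) (n - m), hsub, hadd]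
        linear_combination (2 * (1 - form n m) * ε ^ 2) * hB + 2 * (1 + form n m) * hA +
          (1 - form n m) * (form n m + 1) * hε
      have h1 := not_nonneg_of_disjoint hn hm hdis hnull
        (by
          refine ht_pos_of_form_neg hnull.le ?_ h0 ?_
          · rw [form_smul_left, form_smul_right, ← mul_assoc, hε, one_mul]; exact htl
          · rw [form_add_left]
            simp only [form_smul_left, form_smul_right, form_comm (n + m) (n - m), hsa]
            have h5 := mul_neg_of_pos_of_neg hB0 htl
            have h6 : ε * (B * (ε * form (n - m) (n - m))) + ε * (A * 0) =
                B * form (n - m) (n - m) := by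
              linear_combination (B * form (n - m) (n - m)) * hε
            linarith)
        (by
          rw [form_add_left]
          simp only [form_smul_left, hsn, han]
          have : B * (ε * (1 - form n m)) + A * (1 + form n m) = 2 * A * B * (B - ε * A) := by
            linear_combination (-2 * B * ε) * hA * (-1) + (-2 * A) * hB
          rw [this]
          have : 0 ≤ B - ε * A := by nlinarith
          positivity)
      rw [form_add_left] at h1
      simp only [form_smul_left, hsm, ham] at h1
      have h2 : B * (ε * (form n m - 1)) + A * (1 + form n m) = 2 * A * B * (B + ε * A) := by
        linear_combination (-2 * B * ε) * hA + (-2 * A) * hB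
      rw [h2] at h1
      have h3 : 0 ≤ B + ε * A := by nlinarith
      have h4 : 0 ≤ 2 * A * B * (B + ε * A) := by positivity
      linarith
    have hne : ht (n - m) ≠ 0 := fun h => by
      rw [eq_zero_of_ht_eq_zero htl.le h, form_zero_left] at htl
      exact lt_irrefl _ htl
    rcases hne.lt_or_gt with h | h
    · exact key (-1) (by norm_num) (by rw [ht_smul]; linarith)
    · exact key 1 (by norm_num) (by rw [ht_smul]; linarith)

/-- This vector becomes, after scaling, the foot on the first hyperplane of the common
perpendicular, so it must be on the right sheet. Were it past directed, its negative plus a suitable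
vector orthogonal to `n` and `m` would be a future null vector in both closed half-spaces. -/
lemma ht_sub_smul_pos (hd : 2 ≤ d) : 0 < ht (m - form n m • n) := by
  have hc := form_lt_neg_one_of_disjoint hn hm hdis hd
  set z := m - form n m • n with hz
  have hzz : form z z = 1 - form n m ^ 2 := by
    simp only [hz, form_sub_left, form_sub_right, form_smul_left, form_smul_right, hn, hm,
      form_comm m n]
    ring
  have hzm : form z m = 1 - form n m ^ 2 := by
    simp only [hz, form_sub_left, form_smul_left, hm]
    ring
  have hzn : form z n = 0 := by
    simp only [hz, form_sub_left, form_smul_left, hn, form_comm m n]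
    ring
  have htl : form z z < 0 := by nlinarith
  have hne : ht z ≠ 0 := fun h => by
    rw [eq_zero_of_ht_eq_zero htl.le h, form_zero_left] at htl
    exact lt_irrefl _ htl
  by_contra! hneg
  have h0 : 0 < ht (-z) := by
    rw [ht_neg]
    exact neg_pos.mpr (lt_of_le_of_ne hneg hne)
  obtain ⟨v, hv, hvz, hvn⟩ := exists_unit_orthogonal hd htl n
  have hvm : form v m = 0 := by
    have : m = z + form n m • n := by rw [hz]; abel
    rw [this, form_add_right, form_smul_right, hvz, hvn]; ring
  have hsq : √(-form z z) * √(-form z z) = -form z z := Real.mul_self_sqrt (by linarith)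
  have hnull : form (-z + √(-form z z) • v) (-z + √(-form z z) • v) = 0 := by
    simp only [form_add_left, form_add_right, form_smul_left, form_smul_right, form_neg_left,
      form_neg_right, form_comm z v, hvz, hv]
    linear_combination hsq
  have h1 := not_nonneg_of_disjoint hn hm hdis hnull
    (by
      refine ht_pos_of_form_neg hnull.le ?_ h0 ?_
      · rw [form_neg_left, form_neg_right]; linarith
      · simp only [form_add_left, form_smul_left, form_neg_left, form_neg_right, hvz]
        linarith)
    (by rw [form_add_left, form_smul_left, form_neg_left, hzn, hvn]; simp)
  rw [form_add_left, form_smul_left, form_neg_left, hzm, hvm] at h1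
  linarith

end Disjoint

/-- The point at signed distance `s` from `p` on the geodesic orthogonal at `p` to the hyperplane
with unit normal `n`; positive `s` lead to the side where the product with `n` is negative. -/
def ray (p : Hyp d) (n : Vec d) (h : form n n = 1 ∧ form p.1 n = 0) (s : ℝ) : Hyp d :=
  ⟨Real.cosh s • p.1 - Real.sinh s • n, by
    have hn := h.1
    have hp := h.2
    have e : form (Real.cosh s • p.1 - Real.sinh s • n) (Real.cosh s • p.1 - Real.sinh s • n) =
        -1 := by
      simp only [form_sub_left, form_sub_right, form_smul_left, form_smul_right, form_comm n p.1,
        hn, hp, p.2.1]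
      linear_combination -Real.cosh_sq s
    refine ⟨e, ht_pos_of_form_neg (by rw [e]; norm_num) (hyp_timelike p) p.2.2 ?_⟩
    rw [form_sub_left, form_smul_left, form_smul_left, form_comm n, hp, p.2.1]
    linarith [Real.cosh_pos s]⟩

section Ray

variable {p : Hyp d} {n : Vec d} (h : form n n = 1 ∧ form p.1 n = 0)

lemma ray_zero : ray p n h 0 = p := Subtype.ext (by simp [ray])

lemma hdist_ray (s t : ℝ) : hdist (ray p n h s) (ray p n h t) = |s - t| := by
  have hn := h.1
  have hp := h.2
  refine hdist_eq_of_form ?_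
  simp only [ray, form_sub_left, form_sub_right, form_smul_left, form_smul_right, form_comm n p.1,
    hn, hp, p.2.1, Real.cosh_sub]
  ring

lemma form_ray (s : ℝ) : form (ray p n h s).1 n = -Real.sinh s := by
  have hn := h.1
  have hp := h.2
  simp only [ray, form_sub_left, form_smul_left, hn, hp]
  ring

/-- Points beyond the hyperplane have distance at least `s` from `ray p n h s`. -/
lemma le_hdist_ray {s : ℝ} (hs : 0 ≤ s) {z : Hyp d} (hz : 0 ≤ form z.1 n) :
    s ≤ hdist (ray p n h s) z := by
  rw [le_hdist_iff hs]
  have h1 := one_le_neg_form p z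
  have h2 := Real.cosh_pos s
  have h3 := mul_nonneg (Real.sinh_nonneg_iff.mpr hs) hz
  simp only [ray, form_sub_left, form_smul_left, form_comm n z.1]
  nlinarith

end Ray

/-- The common perpendicular of the boundary hyperplanes of two balls with disjoint closures. -/
lemma exists_perpendicular (hd : 2 ≤ d) {n m : Vec d} (hn : form n n = 1) (hm : form m m = 1)
    (hdis : Disjoint (closure (roundBall n)) (closure (roundBall m))) :
    ∃ D > 0, Real.cosh D = -form n m ∧ ∃ (p q : Hyp d) (hp : form n n = 1 ∧ form p.1 n = 0)
      (hq : form m m = 1 ∧ form q.1 m = 0), ∀ s, ray p n hp s = ray q m hq (D - s) := by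
  have hc := form_lt_neg_one_of_disjoint hn hm hdis hd
  have h0 := ht_sub_smul_pos hn hm hdis hd
  set c := form n m with hcdef
  set D := Real.arcosh (-c) with hD
  have hD0 : 0 < D := Real.arcosh_pos (by linarith)
  have hcosh : Real.cosh D = -c := Real.cosh_arcosh (by linarith)
  have hS : 0 < Real.sinh D := Real.sinh_pos_iff.mpr hD0
  have hcs := Real.cosh_sq D
  rw [hcosh] at hcs
  have hpp : form ((Real.sinh D)⁻¹ • (m - c • n)) ((Real.sinh D)⁻¹ • (m - c • n)) = -1 := by
    simp only [form_sub_left, form_sub_right, form_smul_left, form_smul_right, hn, hm,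
      form_comm m n, ← hcdef]
    field_simp
    linear_combination -hcs
  -- The projection of `m` to the hyperplane of `n`, normalized: its norm is `1 - c² = -sinh² D`.
  let p : Hyp d := ⟨(Real.sinh D)⁻¹ • (m - c • n), hpp, by rw [ht_smul]; positivity⟩
  have hp : form n n = 1 ∧ form p.1 n = 0 := ⟨hn, by
    simp only [p, form_sub_left, form_smul_left, hn, form_comm m n, ← hcdef]
    ring⟩
  have hq : form m m = 1 ∧ form (ray p n hp D).1 m = 0 := ⟨hm, by
    simp only [ray, p, form_sub_left, form_smul_left, hm, ← hcdef, hcosh]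
    field_simp
    linear_combination c * hcs⟩
  refine ⟨D, hD0, hcosh, p, ray p n hp D, hp, hq, fun s => Subtype.ext ?_⟩
  simp only [ray, p, Real.cosh_sub, Real.sinh_sub, hcosh]
  have hne := hS.ne'
  have e : m = Real.sinh D • ((Real.sinh D)⁻¹ • (m - c • n)) + c • n := by
    rw [smul_smul, mul_inv_cancel₀ hne, one_smul]; abel
  obtain ⟨w, hw⟩ : ∃ w, w = (Real.sinh D)⁻¹ • (m - c • n) := ⟨_, rfl⟩
  rw [← hw] at e ⊢
  rw [e]
  match_scalars
  · linear_combination (-Real.cosh s) * hcs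
  · ring_nf
    linear_combination (Real.sinh s) * hcs

/-! ### Boundary hyperplanes and the convex hull of the limit set -/

variable {Γ : Subgroup (G d)}

/-- A geodesic through `v` inside the hyperplane has both end points in `Λ`, and `v` is the midpoint
of suitable null representatives of them. -/
lemma mem_hullCone_of_orthogonal (hd : 2 ≤ d) {n : Vec d}
    (hn : ∀ ξ ∈ sphereInf d, form ξ n = 0 → ξ ∈ limitSet Γ) {v : Vec d} (hv : form v v < 0)
    (h0 : 0 < ht v) (hvn : form v n = 0) : v ∈ hullCone Γ := by
  obtain ⟨u, hu, huv, hun⟩ := exists_unit_orthogonal hd hv n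
  have hsq : √(-form v v) * √(-form v v) = -form v v := Real.mul_self_sqrt (by linarith)
  have key : ∀ ε : ℝ, ε * ε = 1 → v + (ε * √(-form v v)) • u ∈ hullCone Γ := by
    intro ε hε
    have hnull : form (v + (ε * √(-form v v)) • u) (v + (ε * √(-form v v)) • u) = 0 := by
      simp only [form_add_left, form_add_right, form_smul_left, form_smul_right, form_comm v u,
        huv, hu]
      linear_combination hsq * ε ^ 2 - form v v * hε
    have hpos : 0 < ht (v + (ε * √(-form v v)) • u) := by
      refine ht_pos_of_form_neg hnull.le hv h0 ?_
      rw [form_add_left, form_smul_left, huv]; linarith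
    refine mem_hullCone_of_klein hpos (hn _ (klein_mem_sphereInf hnull hpos.ne') ?_)
    rw [form_klein_left, form_add_left, form_smul_left, hvn, hun]; ring
  have h1 := hullCone_smul (hullCone_add (key 1 (by norm_num)) (key (-1) (by norm_num)))
    (a := 1 / 2) (by norm_num)
  have e : (1 / 2 : ℝ) • ((v + ((1 : ℝ) * √(-form v v)) • u) +
      (v + ((-1 : ℝ) * √(-form v v)) • u)) = v := by
    module
  rwa [e] at h1

/-- A point on the inner side of a boundary hyperplane and close to it lies in the hull. -/
lemma mem_hull_of_near_hyperplane (hd : 2 ≤ d) {n : Vec d}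
    (hn : ∀ ξ ∈ sphereInf d, form ξ n = 0 → ξ ∈ limitSet Γ) {q z : Hyp d} (hq : q ∈ hull Γ)
    (hqn : form q.1 n < 0) (hzn : form z.1 n < 0)
    (hlt : 2 * (form z.1 n / form q.1 n) * -form z.1 q.1 < 1) : z ∈ hull Γ := by
  set l := form z.1 n / form q.1 n with hl
  have hl0 : 0 < l := div_pos_of_neg_of_neg hzn hqn
  have hzq := one_le_neg_form z q
  -- This is where the line from `q` through `z` meets the hyperplane; the bound on `l` makes the
  -- point timelike, so `z` is a positive combination of two vectors of the cone.
  have hyn : form (z.1 - l • q.1) n = 0 := by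
    rw [form_sub_left, form_smul_left, hl]
    field_simp [hqn.ne]
    ring
  have hyy : form (z.1 - l • q.1) (z.1 - l • q.1) < 0 := by
    simp only [form_sub_left, form_sub_right, form_smul_left, form_smul_right, z.2.1, q.2.1,
      form_comm q.1 z.1]
    nlinarith [mul_pos hl0 hl0]
  have hy0 : 0 < ht (z.1 - l • q.1) := by
    refine ht_pos_of_form_neg hyy.le (hyp_timelike z) z.2.2 ?_
    rw [form_sub_left, form_smul_left, z.2.1, form_comm q.1]
    nlinarith
  have h1 := hullCone_add (mem_hullCone_of_orthogonal hd hn hyy hy0 hyn)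
    (hullCone_smul (mem_hull_iff.mp hq) hl0)
  rw [sub_add_cancel] at h1
  exact mem_hull_iff.mpr h1

lemma continuous_hyp_form (v : Vec d) : Continuous fun z : Hyp d => form z.1 v :=
  continuous_form continuous_subtype_val continuous_const

lemma exists_mem_interior_hull (hd : 2 ≤ d) {n : Vec d}
    (hn : ∀ ξ ∈ sphereInf d, form ξ n = 0 → ξ ∈ limitSet Γ) {p q : Hyp d}
    (hp : form n n = 1 ∧ form p.1 n = 0) (hq : q ∈ hull Γ) (hqn : form q.1 n < 0) :
    ∃ ε > 0, ∀ z : Hyp d, hdist p z < ε → form z.1 n < 0 → z ∈ interior (hull Γ) := by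
  set K := Real.cosh (1 + hdist p q) with hK
  have hK0 : 0 < K := Real.cosh_pos _
  have hx : 0 < -form q.1 n / (2 * K) := div_pos (by linarith) (by linarith)
  -- The radius 1 keeps `-form z q` below `K`; the other one makes `form z n / form q n` less than
  -- `1 / (2 K)`.
  refine ⟨min 1 (Real.arsinh (-form q.1 n / (2 * K))), lt_min one_pos (Real.arsinh_pos_iff.mpr hx),
    fun z hz hzn => ?_⟩
  have hz1 := hz.trans_le (min_le_left _ _)
  have hz2 := hz.trans_le (min_le_right _ _)
  have hU : IsOpen {z : Hyp d | form z.1 n < 0 ∧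
      2 * (form z.1 n / form q.1 n) * -form z.1 q.1 < 1} :=
    (isOpen_lt (continuous_hyp_form n) continuous_const).inter
      (isOpen_lt ((continuous_const.mul ((continuous_hyp_form n).div_const _)).mul
        (continuous_hyp_form q.1).neg) continuous_const)
  refine mem_interior.mpr ⟨_, fun z hz => mem_hull_of_near_hyperplane hd hn hq hqn hz.1 hz.2,
    hU, hzn, ?_⟩
  have h1 := abs_form_le_sinh hp.1 hp.2 z
  have h2 : Real.sinh (hdist p z) < -form q.1 n / (2 * K) := by
    rw [← Real.sinh_arsinh (-form q.1 n / (2 * K))]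
    exact Real.sinh_lt_sinh.mpr hz2
  have h3 : -form z.1 q.1 ≤ K := by
    rw [← hdist_le_iff (by have := hdist_nonneg p q; linarith)]
    refine (hdist_triangle z p q).trans ?_
    rw [hdist_comm z p]
    linarith
  have h4 : -form z.1 n < -form q.1 n / (2 * K) :=
    ((neg_le_abs _).trans h1).trans_lt h2
  have h5 : form z.1 n / form q.1 n < 1 / (2 * K) := by
    rw [← neg_div_neg_eq, div_lt_div_iff₀ (by linarith) (by linarith)]
    rw [lt_div_iff₀ (by linarith)] at h4
    linarith
  have h6 : 0 < form z.1 n / form q.1 n := div_pos_of_neg_of_neg hzn hqn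
  calc 2 * (form z.1 n / form q.1 n) * -form z.1 q.1 ≤ 2 * (form z.1 n / form q.1 n) * K := by
        gcongr
    _ < 2 * (1 / (2 * K)) * K := by gcongr
    _ = 1 := by field_simp

/-- Points of a boundary hyperplane are not interior to the hull. -/
lemma notMem_interior_hull {n : Vec d} (hn : ∀ ξ ∈ limitSet Γ, form ξ n ≤ 0) {p : Hyp d}
    (hp : form n n = 1 ∧ form p.1 n = 0) : p ∉ interior (hull Γ) := by
  intro hint
  have hc : Continuous (ray p n hp) := by
    refine Continuous.subtype_mk ?_ _
    exact (Real.continuous_cosh.smul continuous_const).sub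
      (Real.continuous_sinh.smul continuous_const)
  have h1 : ∀ᶠ s in 𝓝 (0 : ℝ), ray p n hp s ∈ interior (hull Γ) := by
    refine hc.continuousAt.eventually_mem ?_
    rw [ray_zero]
    exact isOpen_interior.mem_nhds hint
  obtain ⟨s, hs, hs0⟩ := ((h1.filter_mono nhdsWithin_le_nhds).and
    (self_mem_nhdsWithin : ∀ᶠ s in 𝓝[<] (0 : ℝ), s < 0)).exists
  have h2 := form_nonpos_of_mem_hullCone hn (mem_hull_iff.mp (interior_subset hs))
  rw [form_ray] at h2
  have := Real.sinh_neg_iff.mpr hs0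
  linarith

end Balls

/-! ### Discreteness and the distance of the quotient -/

section Quotient

variable {d : ℕ}

lemma isClosed_SOQ : IsClosed (SOQ d : Set (Matrix.SpecialLinearGroup (Idx d) ℝ)) := by
  have : (SOQ d : Set (Matrix.SpecialLinearGroup (Idx d) ℝ)) =
      ⋂ v : Vec d, ⋂ w : Vec d, {g | form (g.1.mulVec v) (g.1.mulVec w) = form v w} := by
    ext g
    simp only [mem_iInter]
    rfl
  rw [this]
  refine isClosed_iInter fun v => isClosed_iInter fun w => isClosed_eq ?_ continuous_const
  exact continuous_form (continuous_subtype_val.matrix_mulVec continuous_const)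
    (continuous_subtype_val.matrix_mulVec continuous_const)

lemma isClosedEmbedding_mat : IsClosedEmbedding (G.mat : G d → Matrix (Idx d) (Idx d) ℝ) := by
  have h1 : IsClosedEmbedding (Subtype.val : G d → SOQ d) :=
    isClosed_connectedComponent.isClosedEmbedding_subtypeVal
  have h2 : IsClosedEmbedding (Subtype.val : SOQ d → Matrix.SpecialLinearGroup (Idx d) ℝ) :=
    isClosed_SOQ.isClosedEmbedding_subtypeVal
  exact (Matrix.SpecialLinearGroup.isClosedEmbedding_val.comp h2).comp h1

lemma isCompact_mat_bounded (C : ℝ) : IsCompact {g : G d | ∀ i j, |g.mat i j| ≤ C} := by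
  have hK : IsCompact (Set.pi univ fun _ : Idx d => Set.pi univ fun _ : Idx d => Icc (-C) C) :=
    isCompact_univ_pi fun _ => isCompact_univ_pi fun _ => isCompact_Icc
  have h := isClosedEmbedding_mat.isCompact_preimage (K := (Set.pi univ fun _ : Idx d =>
    Set.pi univ fun _ : Idx d => Icc (-C) C)) hK
  convert h using 1
  ext g
  exact ⟨fun h i _ j _ => abs_le.mp (h i j), fun h i j => abs_le.mpr (h i trivial j trivial)⟩

lemma form_o (v : Vec d) : form v (o d).1 = -(√2)⁻¹ * ht v := by
  simp only [form, o, ht, Sum.elim_inl, Sum.elim_inr, mul_zero, Finset.sum_const_zero]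
  ring

/-- The Euclidean norm in terms of the form and of the product with the base point. -/
lemma sq_le_form_add (v : Vec d) (i : Idx d) : v i ^ 2 ≤ form v v + 2 * form v (o d).1 ^ 2 := by
  have h2 : (√2)⁻¹ ^ 2 = (2 : ℝ)⁻¹ := by rw [inv_pow, Real.sq_sqrt (by norm_num)]
  have h1 : form v v + 2 * form v (o d).1 ^ 2 =
      v (fstI d) ^ 2 + v (lstI d) ^ 2 + ∑ i : Fin (d - 1), v (midI i) * v (midI i) := by
    rw [form_o, mul_pow, neg_sq, h2]
    simp only [form, ht]
    ring
  have h3 : ∀ i ∈ Finset.univ, 0 ≤ v (midI i) * v (midI (d := d) i) :=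
    fun i _ => mul_self_nonneg _
  have h4 := Finset.sum_nonneg h3
  rw [h1]
  rcases i with ⟨⟩ | i | ⟨⟩
  · change v (fstI d) ^ 2 ≤ _
    nlinarith [sq_nonneg (v (lstI d))]
  · have := Finset.single_le_sum h3 (Finset.mem_univ i)
    change v (midI i) ^ 2 ≤ _
    nlinarith [sq_nonneg (v (lstI d)), sq_nonneg (v (fstI d))]
  · change v (lstI d) ^ 2 ≤ _
    nlinarith [sq_nonneg (v (fstI d))]

/-- Elements of `G` that move a point by a bounded distance have bounded entries. -/
lemma exists_mat_bound (x : Hyp d) (R : ℝ) :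
    ∃ C, ∀ g : G d, hdist x (g • x) ≤ R → ∀ i j, |g.mat i j| ≤ C := by
  set M := Real.cosh (2 * hdist (o d) x + |R|)
  set B := 2 * M ^ 2
  refine ⟨√(1 + 2 * (2 * (√B) ^ 2)), fun g hg i j => ?_⟩
  have h1 : hdist (o d) (g • o d) ≤ 2 * hdist (o d) x + |R| := by
    have a1 := hdist_triangle (o d) x (g • o d)
    have a2 := hdist_triangle x (g • x) (g • o d)
    rw [hdist_smul, hdist_comm x (o d)] at a2
    have := le_abs_self R
    linarith
  have hR : 0 ≤ 2 * hdist (o d) x + |R| := by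
    have := hdist_nonneg (o d) x
    positivity
  rw [hdist_le_iff hR] at h1
  have h2 : form (g⁻¹.mat.mulVec (o d).1) (o d).1 = form (o d).1 (g • o d).1 := by
    rw [← form_mat g, mulVec_mulVec_inv]
    rfl
  have h3 : form (g⁻¹.mat.mulVec (o d).1) (o d).1 ^ 2 ≤ M ^ 2 := by
    rw [h2, ← neg_sq]
    have := one_le_neg_form (o d) (g • o d)
    exact pow_le_pow_left₀ (by linarith) h1 2
  have h4 : ∀ i, |(g⁻¹.mat.mulVec (o d).1) i| ≤ √B := by
    intro i
    refine Real.abs_le_sqrt ((sq_le_form_add _ i).trans ?_)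
    rw [form_mat, (o d).2.1]
    simp only [B]
    linarith
  -- The product of the column `g e_j` with `o` is, since `g` preserves the form, a coordinate of
  -- `g⁻¹ o`, and that vector is already bounded.
  have h5 : form (Pi.single j 1) (g⁻¹.mat.mulVec (o d).1) =
      form (g.mat.mulVec (Pi.single j 1)) (o d).1 := by
    rw [← form_mat g, mulVec_mulVec_inv]
  have h6 : form (g.mat.mulVec (Pi.single j 1)) (o d).1 ^ 2 ≤ 2 * (√B) ^ 2 := by
    rw [← h5]
    have hB := Real.sqrt_nonneg B
    have hb : |form (Pi.single j 1) (g⁻¹.mat.mulVec (o d).1)| ≤ √B := by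
      rcases j with ⟨⟩ | j | ⟨⟩
      · simpa [form, Pi.single_apply] using h4 (lstI d)
      · simpa [form, Pi.single_apply] using h4 (midI j)
      · simpa [form, Pi.single_apply] using h4 (fstI d)
    have := sq_le_sq' (abs_le.mp hb).1 (abs_le.mp hb).2
    nlinarith [sq_nonneg (√B)]
  have h7 : g.mat i j = g.mat.mulVec (Pi.single j 1) i := by
    rw [Matrix.mulVec_single_one]; rfl
  rw [h7]
  refine Real.abs_le_sqrt ((sq_le_form_add _ i).trans ?_)
  rw [form_mat]
  have h8 : form (Pi.single j 1 : Vec d) (Pi.single j 1) ≤ 1 := by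
    rcases j with ⟨⟩ | j | ⟨⟩ <;> simp [form, Pi.single_apply]
  linarith

variable {Γ : Subgroup (G d)}

/-- Bounded displacement confines `γ` to a compact set of matrices, which a closed discrete subgroup
meets in a finite set. -/
lemma finite_setOf_hdist_le [DiscreteTopology Γ] (x : Hyp d) (R : ℝ) :
    {γ : G d | γ ∈ Γ ∧ hdist x (γ • x) ≤ R}.Finite := by
  obtain ⟨C, hC⟩ := exists_mat_bound x R
  have hcl : IsClosed (Γ : Set (G d)) := Subgroup.isClosed_of_discrete
  have h1 : IsCompact ((Γ : Set (G d)) ∩ {g : G d | ∀ i j, |g.mat i j| ≤ C}) :=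
    (isCompact_mat_bounded C).inter_left hcl
  have h2 : IsDiscrete ((Γ : Set (G d)) ∩ {g : G d | ∀ i j, |g.mat i j| ≤ C}) :=
    IsDiscrete.mono ⟨‹DiscreteTopology Γ›⟩ inter_subset_left
  exact (h1.finite h2).subset fun γ hγ => ⟨hγ.1, hC γ hγ.2⟩

lemma hdist_pow_smul_self {γ : G d} {x : Hyp d} (h : γ • x = x) (n : ℕ) : γ ^ n • x = x := by
  induction n with
  | zero => simp
  | succ n ih => rw [pow_succ, mul_smul, h, ih]

/-- A discrete torsion-free group acts freely, with a positive injectivity radius at each point. -/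
lemma exists_le_hdist_smul [DiscreteTopology Γ] (htf : ∀ γ ∈ Γ, IsOfFinOrder γ → γ = 1)
    (x : Hyp d) : ∃ ε > 0, ∀ γ ∈ Γ, γ ≠ 1 → ε ≤ hdist x (γ • x) := by
  have hpos : ∀ γ ∈ Γ, γ ≠ 1 → 0 < hdist x (γ • x) := by
    intro γ hγ hne
    refine (hdist_nonneg _ _).lt_of_ne fun h0 => hne (htf γ hγ ?_)
    have hfix : γ • x = x := (eq_of_hdist_eq_zero h0.symm).symm
    -- All powers of an element fixing `x` have zero displacement there, so they are finitely many.
    have hfin : (Set.range fun n : ℕ => γ ^ n).Finite :=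
      (finite_setOf_hdist_le (Γ := Γ) x 0).subset (by
        rintro _ ⟨n, rfl⟩
        refine ⟨Γ.pow_mem hγ n, ?_⟩
        rw [hdist_pow_smul_self hfix, hdist_self])
    have hfin' : (Submonoid.powers γ : Set (G d)).Finite := hfin
    exact finite_powers.mp hfin'
  have hfin : {γ : G d | (γ ∈ Γ ∧ hdist x (γ • x) ≤ 1) ∧ γ ≠ 1}.Finite :=
    (finite_setOf_hdist_le (Γ := Γ) x 1).subset fun γ h => h.1
  obtain ⟨ε, hε, h⟩ : ∃ ε > 0, ∀ γ ∈ {γ : G d | (γ ∈ Γ ∧ hdist x (γ • x) ≤ 1) ∧ γ ≠ 1},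
      ε ≤ hdist x (γ • x) := by
    rcases Set.eq_empty_or_nonempty {γ : G d | (γ ∈ Γ ∧ hdist x (γ • x) ≤ 1) ∧ γ ≠ 1} with he | hne
    · exact ⟨1, one_pos, by rw [he]; simp⟩
    · obtain ⟨γ₀, h₀, hmin⟩ := exists_min_image _ (fun γ => hdist x (γ • x)) hfin hne
      exact ⟨_, hpos γ₀ h₀.1.1 h₀.2, hmin⟩
  refine ⟨min ε 1, lt_min hε one_pos, fun γ hγ hne => ?_⟩
  by_cases h1 : hdist x (γ • x) ≤ 1
  · exact (min_le_left _ _).trans (h γ ⟨⟨hγ, h1⟩, hne⟩)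
  · exact (min_le_right _ _).trans (not_le.mp h1).le

/-! ### The distance of `M` and the topology of its core -/

lemma mk_eq_iff {p q : Hyp d} : (⟦p⟧ : Mfd Γ) = ⟦q⟧ ↔ ∃ γ : Γ, γ • q = p := by
  rw [Quotient.eq]
  exact MulAction.orbitRel_apply

lemma mk_smul (γ : Γ) (p : Hyp d) : (⟦γ • p⟧ : Mfd Γ) = ⟦p⟧ := mk_eq_iff.mpr ⟨γ, rfl⟩

lemma mdist_bddBelow (x y : Mfd Γ) :
    BddBelow {r | ∃ p q : Hyp d, (⟦p⟧ : Mfd Γ) = x ∧ (⟦q⟧ : Mfd Γ) = y ∧ r = hdist p q} :=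
  ⟨0, by rintro r ⟨p, q, -, -, rfl⟩; exact hdist_nonneg p q⟩

lemma mdist_mk_le (p q : Hyp d) : mdist (⟦p⟧ : Mfd Γ) ⟦q⟧ ≤ hdist p q :=
  csInf_le (mdist_bddBelow _ _) ⟨p, q, rfl, rfl, rfl⟩

lemma le_mdist {x y : Mfd Γ} {r : ℝ}
    (h : ∀ p q : Hyp d, (⟦p⟧ : Mfd Γ) = x → (⟦q⟧ : Mfd Γ) = y → r ≤ hdist p q) :
    r ≤ mdist x y := by
  refine le_csInf ?_ ?_
  · obtain ⟨p, hp⟩ := Quotient.exists_rep x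
    obtain ⟨q, hq⟩ := Quotient.exists_rep y
    exact ⟨_, p, q, hp, hq, rfl⟩
  · rintro _ ⟨p, q, hp, hq, rfl⟩
    exact h p q hp hq

lemma mdist_nonneg (x y : Mfd Γ) : 0 ≤ mdist x y := le_mdist fun p q _ _ => hdist_nonneg p q

lemma mdist_comm (x y : Mfd Γ) : mdist x y = mdist y x :=
  le_antisymm
    (le_mdist fun p q hp hq => by subst hp hq; rw [hdist_comm]; exact mdist_mk_le q p)
    (le_mdist fun p q hp hq => by subst hp hq; rw [hdist_comm]; exact mdist_mk_le q p)

lemma mdist_self (x : Mfd Γ) : mdist x x = 0 := by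
  obtain ⟨p, rfl⟩ := Quotient.exists_rep x
  exact le_antisymm ((mdist_mk_le p p).trans (hdist_self p).le) (mdist_nonneg _ _)

lemma subgroup_hdist_smul (γ : Γ) (p q : Hyp d) : hdist (γ • p) (γ • q) = hdist p q :=
  hdist_smul (γ : G d) p q

/-- One representative may be fixed in the infimum that defines the distance. -/
lemma le_mdist_mk {p : Hyp d} {y : Mfd Γ} {r : ℝ}
    (h : ∀ q : Hyp d, (⟦q⟧ : Mfd Γ) = y → r ≤ hdist p q) : r ≤ mdist ⟦p⟧ y := by
  refine le_mdist fun p' q' hp hq => ?_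
  obtain ⟨γ, rfl⟩ := mk_eq_iff.mp hp
  have := h (γ⁻¹ • q') (by rw [mk_smul, hq])
  rwa [← subgroup_hdist_smul γ, smul_inv_smul] at this

lemma mdist_triangle (x y z : Mfd Γ) : mdist x z ≤ mdist x y + mdist y z := by
  obtain ⟨q, rfl⟩ := Quotient.exists_rep y
  rw [← sub_le_iff_le_add']
  refine le_mdist_mk fun r hr => ?_
  rw [sub_le_comm, mdist_comm x ⟦q⟧]
  refine le_mdist_mk fun p hp => ?_
  subst hr hp
  have h1 := mdist_mk_le (Γ := Γ) p r
  have h2 := hdist_triangle p q r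
  rw [hdist_comm p q] at h2
  linarith

/-- Locally the quotient map is an isometry. -/
lemma exists_mdist_eq_hdist [DiscreteTopology Γ] (htf : ∀ γ ∈ Γ, IsOfFinOrder γ → γ = 1)
    (x : Hyp d) : ∃ ε > 0, ∀ p q : Hyp d, hdist x p < ε → hdist x q < ε →
      mdist (⟦p⟧ : Mfd Γ) ⟦q⟧ = hdist p q := by
  obtain ⟨ε, hε, h⟩ := exists_le_hdist_smul htf x
  -- A nontrivial translate of `q` stays at least `ε - 2 (ε / 4) = ε / 2` away from `p`, farther
  -- than `q` itself.
  refine ⟨ε / 4, by positivity, fun p q hp hq => le_antisymm (mdist_mk_le p q) ?_⟩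
  refine le_mdist_mk fun q' hq' => ?_
  obtain ⟨γ, rfl⟩ := mk_eq_iff.mp hq'
  by_cases h1 : (γ : G d) = 1
  · rw [show γ = 1 from Subtype.ext h1, one_smul]
  · have a1 : ε ≤ hdist x (γ • x) := h γ γ.2 h1
    have a2 := hdist_triangle x p (γ • x)
    have a3 := hdist_triangle p (γ • q) (γ • x)
    rw [subgroup_hdist_smul, hdist_comm q x] at a3
    have a4 := hdist_triangle p x q
    rw [hdist_comm p x] at a4
    linarith

instance : ContinuousConstSMul Γ (Hyp d) :=
  ⟨fun γ => Continuous.subtype_mk ((continuous_mulVec (γ : G d)).comp continuous_subtype_val) _⟩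

lemma isOpenMap_mk : IsOpenMap fun x : Hyp d => (⟦x⟧ : Mfd Γ) :=
  isOpenMap_quotient_mk'_mul

lemma mk_mem_core_iff {x : Hyp d} : (⟦x⟧ : Mfd Γ) ∈ core Γ ↔ x ∈ hull Γ := by
  constructor
  · rintro ⟨y, hy, hyx⟩
    obtain ⟨γ, rfl⟩ := mk_eq_iff.mp hyx.symm
    exact smul_mem_hull γ hy
  · exact fun h => ⟨x, h, rfl⟩

/-- The quotient map is continuous and open, and the hull is `Γ`-invariant. -/
lemma mk_mem_interior_core_iff {x : Hyp d} :
    (⟦x⟧ : Mfd Γ) ∈ interior (core Γ) ↔ x ∈ interior (hull Γ) := by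
  constructor
  · intro h
    refine mem_interior.mpr ⟨(fun x => (⟦x⟧ : Mfd Γ)) ⁻¹' interior (core Γ), fun y hy =>
      mk_mem_core_iff.mp (interior_subset hy), ?_, h⟩
    exact isOpen_interior.preimage continuous_quotient_mk'
  · intro h
    refine mem_interior.mpr ⟨(fun x => (⟦x⟧ : Mfd Γ)) '' interior (hull Γ), ?_,
      isOpenMap_mk _ isOpen_interior, x, h, rfl⟩
    exact image_mono interior_subset

lemma mk_mem_coreBoundary {x : Hyp d} (hx : x ∈ hull Γ) (h : x ∉ interior (hull Γ)) :
    (⟦x⟧ : Mfd Γ) ∈ coreBoundary Γ :=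
  ⟨subset_closure (mk_mem_core_iff.mpr hx), fun h' => h (mk_mem_interior_core_iff.mp h')⟩

/-- Near a boundary hyperplane the distance to the boundary of the core is the distance to this
hyperplane. -/
lemma exists_le_mdist_coreBoundary (hd : 2 ≤ d) {n : Vec d}
    (hn : ∀ ξ ∈ sphereInf d, form ξ n = 0 → ξ ∈ limitSet Γ) {p q : Hyp d}
    (hp : form n n = 1 ∧ form p.1 n = 0) (hq : q ∈ hull Γ) (hqn : form q.1 n < 0) :
    ∃ ε > 0, ∀ s, 0 ≤ s → s < ε → ∀ z ∈ core Γ, z ∈ coreBoundary Γ →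
      s ≤ mdist (⟦ray p n hp s⟧ : Mfd Γ) z := by
  obtain ⟨ε, hε, h⟩ := exists_mem_interior_hull hd hn hp hq hqn
  -- A boundary point on the inner side is at least `ε` from `p`, hence at least `ε - s > s` from
  -- the point of the ray.
  refine ⟨ε / 2, by positivity, fun s hs hsε z hz hzb => le_mdist_mk ?_⟩
  rintro z rfl
  rcases le_or_gt 0 (form z.1 n) with h0 | h0
  · exact le_hdist_ray hp hs h0
  · have h1 : ε ≤ hdist p z := by
      by_contra! h2
      exact hzb.2 (mk_mem_interior_core_iff.mpr (h z h2 h0))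
    have h2 := hdist_triangle p (ray p n hp s) z
    have h3 := hdist_ray hp 0 s
    rw [ray_zero, zero_sub, abs_neg, abs_of_nonneg hs] at h3
    linarith

end Quotient

/-! ### Closed geodesics of the double -/

section DoubleGeodesic

variable {d : ℕ} {Γ : Subgroup (G d)}

lemma double_mk_eq {x y : core Γ} {i j : Bool} (h : (⟦(x, i)⟧ : Double Γ) = ⟦(y, j)⟧) :
    x = y ∧ (i = j ∨ x.1 ∈ coreBoundary Γ) := Quotient.exact h

/-- The set of lengths whose infimum is the gluing metric. -/
def ddistSet (a b : Double Γ) : Set ℝ :=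
  {r | ∃ (x y : core Γ) (i : Bool), (⟦(x, i)⟧ : Double Γ) = a ∧ (⟦(y, i)⟧ : Double Γ) = b ∧
      r = mdist x.1 y.1} ∪
    {r | ∃ (x y z : core Γ) (i j : Bool), (⟦(x, i)⟧ : Double Γ) = a ∧
      (⟦(y, j)⟧ : Double Γ) = b ∧ z.1 ∈ coreBoundary Γ ∧ r = mdist x.1 z.1 + mdist z.1 y.1}

lemma bddBelow_ddistSet (a b : Double Γ) : BddBelow (ddistSet a b) := by
  refine ⟨0, ?_⟩
  rintro r (⟨x, y, i, -, -, rfl⟩ | ⟨x, y, z, i, j, -, -, -, rfl⟩)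
  · exact mdist_nonneg _ _
  · exact add_nonneg (mdist_nonneg _ _) (mdist_nonneg _ _)

/-- A detour through the boundary never shortens the way, by the triangle inequality of `mdist`. -/
lemma ddist_same_copy (x y : core Γ) (i : Bool) :
    ddist (⟦(x, i)⟧ : Double Γ) ⟦(y, i)⟧ = mdist x.1 y.1 := by
  have hmem : mdist x.1 y.1 ∈ ddistSet (⟦(x, i)⟧ : Double Γ) ⟦(y, i)⟧ :=
    Or.inl ⟨x, y, i, rfl, rfl, rfl⟩
  refine le_antisymm (csInf_le (bddBelow_ddistSet _ _) hmem) (le_csInf ⟨_, hmem⟩ ?_)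
  rintro r (⟨x', y', i, hx, hy, rfl⟩ | ⟨x', y', z, i, j, hx, hy, -, rfl⟩)
  · rw [(double_mk_eq hx).1, (double_mk_eq hy).1]
  · rw [(double_mk_eq hx).1, (double_mk_eq hy).1]
    exact mdist_triangle _ _ _

lemma ddist_le_via (x y : core Γ) {z : core Γ} (hz : z.1 ∈ coreBoundary Γ) (i j : Bool) :
    ddist (⟦(x, i)⟧ : Double Γ) ⟦(y, j)⟧ ≤ mdist x.1 z.1 + mdist z.1 y.1 :=
  csInf_le (bddBelow_ddistSet _ _) (Or.inr ⟨x, y, z, i, j, rfl, rfl, hz, rfl⟩)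

/-- Changing copies requires a boundary point. Two points of different copies can be represented in
one copy only if one of them is itself on the boundary, and it then serves as the crossing point. -/
lemma le_ddist_of_ne {x y z₀ : core Γ} (hz₀ : z₀.1 ∈ coreBoundary Γ) {i j : Bool} (hij : i ≠ j)
    {r s : ℝ} (hr : ∀ z ∈ core Γ, z ∈ coreBoundary Γ → r ≤ mdist x.1 z)
    (hs : ∀ z ∈ core Γ, z ∈ coreBoundary Γ → s ≤ mdist y.1 z) :
    r + s ≤ ddist (⟦(x, i)⟧ : Double Γ) ⟦(y, j)⟧ := by
  have key : ∀ z : core Γ, z.1 ∈ coreBoundary Γ → r + s ≤ mdist x.1 z.1 + mdist z.1 y.1 := by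
    intro z hz
    rw [mdist_comm z.1]
    exact add_le_add (hr z z.2 hz) (hs z z.2 hz)
  refine le_csInf ⟨_, Or.inr ⟨x, y, z₀, i, j, rfl, rfl, hz₀, rfl⟩⟩ ?_
  rintro t (⟨x', y', k, hx, hy, rfl⟩ | ⟨x', y', z, k, l, hx, hy, hz, rfl⟩)
  · obtain ⟨rfl, hx'⟩ := double_mk_eq hx
    obtain ⟨rfl, hy'⟩ := double_mk_eq hy
    rcases hx' with hx' | hx'
    · rcases hy' with hy' | hy'
      · exact absurd (hx'.symm.trans hy') hij
      · have := key y' hy'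
        rwa [mdist_self, add_zero] at this
    · have := key x' hx'
      rwa [mdist_self, zero_add] at this
  · obtain ⟨rfl, -⟩ := double_mk_eq hx
    obtain ⟨rfl, -⟩ := double_mk_eq hy
    exact key z hz

/-- An arc of the core that starts on the boundary, followed in both copies. -/
def reflected (β : ℝ → core Γ) (b : Bool) (t : ℝ) : Double Γ :=
  ⟦(β |t|, if 0 ≤ t then b else !b)⟧

/-- Across the boundary the distance is `|s| + |s'|`: at most this by way of `β 0`, and at least
this because by `h2` each of the two points is that far from the whole boundary. -/
lemma ddist_reflected {β : ℝ → core Γ} {D ε₁ ε₂ : ℝ} (hD : 0 < D) (hε₁ : 0 < ε₁) (hε₂ : 0 < ε₂)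
    (h0 : (β 0).1 ∈ coreBoundary Γ)
    (h1 : ∀ s ∈ Icc 0 D, ∀ s' ∈ Icc 0 D, s < ε₁ → s' < ε₁ →
      mdist (β s).1 (β s').1 = |s - s'|)
    (h2 : ∀ s ∈ Icc 0 D, s < ε₂ → ∀ z ∈ core Γ, z ∈ coreBoundary Γ → s ≤ mdist (β s).1 z)
    (b : Bool) : ∃ ε > 0, ε ≤ D ∧ ∀ s ∈ Ioo (-ε) ε, ∀ s' ∈ Ioo (-ε) ε,
      ddist (reflected β b s) (reflected β b s') = |s - s'| := by
  refine ⟨min D (min ε₁ ε₂), by positivity, min_le_left _ _, fun s hs s' hs' => ?_⟩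
  have a := abs_lt.mpr hs
  have a' := abs_lt.mpr hs'
  rw [lt_min_iff, lt_min_iff] at a a'
  have i : |s| ∈ Icc 0 D := ⟨abs_nonneg _, a.1.le⟩
  have i' : |s'| ∈ Icc 0 D := ⟨abs_nonneg _, a'.1.le⟩
  have same : mdist (β |s|).1 (β |s'|).1 = |(|s| - |s'|)| := h1 _ i _ i' a.2.1 a'.2.1
  have cross : ∀ c c' : Bool, c ≠ c' →
      ddist (⟦(β |s|, c)⟧ : Double Γ) ⟦(β |s'|, c')⟧ = |s| + |s'| := by
    intro c c' hc
    refine le_antisymm ((ddist_le_via _ _ h0 c c').trans ?_)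
      (le_ddist_of_ne h0 hc (h2 _ i a.2.2) (h2 _ i' a'.2.2))
    rw [h1 _ i 0 ⟨le_rfl, hD.le⟩ a.2.1 hε₁, h1 0 ⟨le_rfl, hD.le⟩ _ i' hε₁ a'.2.1, sub_zero,
      zero_sub, abs_neg, abs_abs, abs_abs]
  unfold reflected
  by_cases p : 0 ≤ s <;> by_cases p' : 0 ≤ s'
  · rw [if_pos p, if_pos p', ddist_same_copy, same, abs_of_nonneg p, abs_of_nonneg p']
  · rw [if_pos p, if_neg p', cross _ _ (by simp), abs_of_nonneg p, abs_of_neg (not_le.mp p'),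
      abs_of_nonneg (by linarith)]
    ring
  · rw [if_neg p, if_pos p', cross _ _ (by simp), abs_of_nonneg p', abs_of_neg (not_le.mp p),
      abs_of_nonpos (by linarith)]
    ring
  · rw [if_neg p, if_neg p', ddist_same_copy, same, abs_of_neg (not_le.mp p),
      abs_of_neg (not_le.mp p'), ← abs_neg]
    congr 1; ring

/-- A geodesic arc of the core that realizes the distance to the boundary near its end points,
followed back and forth in the two copies, is a closed geodesic of the double. -/
lemma hasClosedGeodesic_of_arc {β : ℝ → core Γ} {D ε : ℝ} (hD : 0 < D) (hε : 0 < ε)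
    (h1 : ∀ t ∈ Icc 0 D, ∃ ε > 0, ∀ s ∈ Icc 0 D, ∀ s' ∈ Icc 0 D, |s - t| < ε → |s' - t| < ε →
      mdist (β s).1 (β s').1 = |s - s'|)
    (h0 : (β 0).1 ∈ coreBoundary Γ) (hD' : (β D).1 ∈ coreBoundary Γ)
    (h2 : ∀ s ∈ Icc 0 D, s < ε → ∀ z ∈ core Γ, z ∈ coreBoundary Γ → s ≤ mdist (β s).1 z)
    (h3 : ∀ s ∈ Icc 0 D, s < ε → ∀ z ∈ core Γ, z ∈ coreBoundary Γ → s ≤ mdist (β (D - s)).1 z) :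
    HasClosedGeodesic Γ (2 * D) := by
  have hp : 0 < 2 * D := by linarith
  -- On the period [-D, D) the arc is traversed backwards in the copy `false`, then forwards in the
  -- copy `true`.
  set c : ℝ → Double Γ := fun t => reflected β true (toIcoMod hp (-D) t) with hc
  have c_self : ∀ t, -D ≤ t → t < D → c t = reflected β true t := by
    intro t a b
    simp only [hc]
    rw [(toIcoMod_eq_self hp).mpr ⟨a, by linarith⟩]
  have c_per : ∀ t, c (t + 2 * D) = c t := by
    intro t
    simp only [hc, toIcoMod_add_right]
  have local_at : ∀ t, -D ≤ t → t < D → ∃ ε > 0, ∀ s ∈ Ioo (t - ε) (t + ε),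
      ∀ s' ∈ Ioo (t - ε) (t + ε), ddist (c s) (c s') = |s - s'| := by
    intro t ht ht'
    rcases ht.eq_or_lt with rfl | ht
    -- At `-D` the curve passes through `β D`. There it is the reflection of the reversed arc,
    -- entering the copy `false`; periodicity supplies the parameters before `-D`.
    · obtain ⟨ε₁, hε₁, h⟩ := h1 D ⟨hD.le, le_rfl⟩
      obtain ⟨δ, hδ, hδD, h4⟩ := ddist_reflected (β := fun s => β (D - s)) hD hε₁ hε
        (by simpa using hD') (fun s hs s' hs' hsε hsε' => by
          have := h (D - s) ⟨by linarith [hs.2], by linarith [hs.1]⟩ (D - s')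
            ⟨by linarith [hs'.2], by linarith [hs'.1]⟩
            (by rw [sub_sub_cancel_left, abs_neg, abs_of_nonneg hs.1]; exact hsε)
            (by rw [sub_sub_cancel_left, abs_neg, abs_of_nonneg hs'.1]; exact hsε')
          rw [this, ← abs_neg]
          congr 1; ring) h3 false
      have key : ∀ s ∈ Ioo (-D - δ) (-D + δ), c s = reflected (fun s => β (D - s)) false (s + D) := by
        intro s hs
        by_cases h5 : -D ≤ s
        · rw [c_self s h5 (by linarith [hs.2]), reflected, reflected,
            if_neg (by linarith [hs.2]), if_pos (by linarith), abs_of_neg (by linarith [hs.2]),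
            abs_of_nonneg (by linarith)]
          congr 3
          ring
        · rw [← c_per, c_self (s + 2 * D) (by linarith [hs.1]) (by linarith), reflected, reflected,
            if_pos (by linarith [hs.1]), if_neg (by linarith), abs_of_nonneg (by linarith [hs.1]),
            abs_of_neg (by linarith)]
          congr 3
          ring
      refine ⟨δ, hδ, fun s hs s' hs' => ?_⟩
      rw [key s hs, key s' hs', h4 _ ⟨by linarith [hs.1], by linarith [hs.2]⟩ _
        ⟨by linarith [hs'.1], by linarith [hs'.2]⟩]
      congr 1; ring
    rcases eq_or_ne t 0 with rfl | h00
    · obtain ⟨ε₁, hε₁, h⟩ := h1 0 ⟨le_rfl, hD.le⟩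
      obtain ⟨δ, hδ, hδD, h4⟩ := ddist_reflected hD hε₁ hε h0 (fun s hs s' hs' hsε hsε' =>
        h s hs s' hs' (by rw [sub_zero, abs_of_nonneg hs.1]; exact hsε)
          (by rw [sub_zero, abs_of_nonneg hs'.1]; exact hsε')) h2 true
      refine ⟨δ, hδ, fun s hs s' hs' => ?_⟩
      rw [zero_sub, zero_add] at hs hs'
      rw [c_self s (by linarith [hs.1]) (by linarith [hs.2]),
        c_self s' (by linarith [hs'.1]) (by linarith [hs'.2]), h4 s hs s' hs']
    -- Away from the turning points the curve stays in one copy, where the distance is that of the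
    -- core.
    · have htD : |t| < D := abs_lt.mpr ⟨ht, ht'⟩
      have ht0 : 0 < |t| := abs_pos.mpr h00
      obtain ⟨ε₁, hε₁, h⟩ := h1 |t| ⟨ht0.le, htD.le⟩
      refine ⟨min ε₁ (min |t| (D - |t|)), lt_min hε₁ (lt_min ht0 (by linarith)),
        fun s hs s' hs' => ?_⟩
      have near : ∀ s ∈ Ioo (t - min ε₁ (min |t| (D - |t|))) (t + min ε₁ (min |t| (D - |t|))),
          |s - t| < ε₁ ∧ |s - t| < |t| ∧ |s - t| < D - |t| := by
        intro s hs
        have : |s - t| < min ε₁ (min |t| (D - |t|)) :=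
          abs_lt.mpr ⟨by linarith [hs.1], by linarith [hs.2]⟩
        rwa [lt_min_iff, lt_min_iff] at this
      obtain ⟨n1, n2, n3⟩ := near s hs
      obtain ⟨n1', n2', n3'⟩ := near s' hs'
      have b1 := lt_of_le_of_lt (abs_sub_abs_le_abs_sub s t) n3
      have b1' := lt_of_le_of_lt (abs_sub_abs_le_abs_sub s' t) n3'
      have b2 : |s| < D := by linarith
      have b2' : |s'| < D := by linarith
      have k1 : |(|s| - |t|)| < ε₁ := lt_of_le_of_lt (abs_abs_sub_abs_le_abs_sub s t) n1
      have k1' : |(|s'| - |t|)| < ε₁ := lt_of_le_of_lt (abs_abs_sub_abs_le_abs_sub s' t) n1'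
      have hd := h _ ⟨abs_nonneg _, b2.le⟩ _ ⟨abs_nonneg _, b2'.le⟩ k1 k1'
      rw [c_self s (abs_lt.mp b2).1.le (abs_lt.mp b2).2,
        c_self s' (abs_lt.mp b2').1.le (abs_lt.mp b2').2, reflected, reflected]
      have n4 := abs_lt.mp n2
      have n4' := abs_lt.mp n2'
      rcases h00.lt_or_gt with h5 | h5
      · rw [abs_of_neg h5] at n4 n4'
        have q : s < 0 := by linarith [n4.2]
        have q' : s' < 0 := by linarith [n4'.2]
        rw [if_neg q.not_ge, if_neg q'.not_ge, ddist_same_copy, hd, abs_of_neg q, abs_of_neg q',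
          ← abs_neg]
        congr 1; ring
      · rw [abs_of_pos h5] at n4 n4'
        have q : 0 < s := by linarith [n4.1]
        have q' : 0 < s' := by linarith [n4'.1]
        rw [if_pos q.le, if_pos q'.le, ddist_same_copy, hd, abs_of_pos q, abs_of_pos q']
  refine ⟨hp, c, c_per, fun t => ?_⟩
  obtain ⟨δ, hδ, h⟩ := local_at (toIcoMod hp (-D) t) (left_le_toIcoMod hp _ _)
    (by have := toIcoMod_lt_right hp (-D) t; linarith)
  set k := toIcoDiv hp (-D) t • (2 * D) with hk
  have ht : toIcoMod hp (-D) t = t - k := rfl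
  have c_k : ∀ s, c s = c (s - k) := by
    intro s
    simp only [hc, hk, toIcoMod_sub_zsmul]
  refine ⟨δ, hδ, fun s hs s' hs' => ?_⟩
  rw [ht] at h
  rw [c_k s, c_k s', h _ ⟨by linarith [hs.1], by linarith [hs.2]⟩ _
    ⟨by linarith [hs'.1], by linarith [hs'.2]⟩]
  congr 1; ring

lemma ray_mem_hull {p : Hyp d} {n : Vec d} (h : form n n = 1 ∧ form p.1 n = 0) {D : ℝ}
    (hp : p ∈ hull Γ) (hq : ray p n h D ∈ hull Γ) {s : ℝ} (hs : s ∈ Icc 0 D) :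
    ray p n h s ∈ hull Γ := by
  rcases hs.1.eq_or_lt with rfl | h0
  · rwa [ray_zero]
  rcases hs.2.eq_or_lt with rfl | h1
  · exact hq
  have hD := Real.sinh_pos_iff.mpr (h0.trans h1)
  -- The sinh interpolation formula writes a point of a geodesic segment as a positive combination
  -- of its ends.
  have e : (Real.sinh D)⁻¹ • (Real.sinh (D - s) • p.1 + Real.sinh s • (ray p n h D).1) =
      (ray p n h s).1 := by
    simp only [ray, Real.sinh_sub]
    match_scalars <;> field_simp
    ring
  rw [mem_hull_iff, ← e]
  exact hullCone_smul (hullCone_add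
    (hullCone_smul (mem_hull_iff.mp hp) (Real.sinh_pos_iff.mpr (by linarith)))
    (hullCone_smul (mem_hull_iff.mp hq) (Real.sinh_pos_iff.mpr h0))) (inv_pos.mpr hD)

/-- The common perpendicular of two boundary hyperplanes of the hull gives a closed geodesic of
the double. -/
lemma exists_hasClosedGeodesic (hd : 2 ≤ d) [DiscreteTopology Γ]
    (htf : ∀ γ ∈ Γ, IsOfFinOrder γ → γ = 1) {n m : Vec d} (hn : form n n = 1) (hm : form m m = 1)
    (hdis : Disjoint (closure (roundBall n)) (closure (roundBall m)))
    (hbn : ∀ ξ ∈ sphereInf d, form ξ n = 0 → ξ ∈ limitSet Γ)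
    (hbm : ∀ ξ ∈ sphereInf d, form ξ m = 0 → ξ ∈ limitSet Γ)
    (hln : ∀ ξ ∈ limitSet Γ, form ξ n ≤ 0) (hlm : ∀ ξ ∈ limitSet Γ, form ξ m ≤ 0) :
    ∃ D > 0, Real.cosh D = -form n m ∧ HasClosedGeodesic Γ (2 * D) := by
  obtain ⟨D, hD, hcosh, p, q, hp, hq, hpq⟩ := exists_perpendicular hd hn hm hdis
  refine ⟨D, hD, hcosh, ?_⟩
  have hqe : ray p n hp D = q := by rw [hpq, sub_self, ray_zero]
  have hpe : ray q m hq D = p := by rw [← ray_zero hp, hpq, sub_zero]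
  have hpH : p ∈ hull Γ :=
    mem_hull_iff.mpr (mem_hullCone_of_orthogonal hd hbn (hyp_timelike p) p.2.2 hp.2)
  have hqH : q ∈ hull Γ :=
    mem_hull_iff.mpr (mem_hullCone_of_orthogonal hd hbm (hyp_timelike q) q.2.2 hq.2)
  have hsD := Real.sinh_pos_iff.mpr hD
  have hqn : form q.1 n < 0 := by rw [← hqe, form_ray]; linarith
  have hpm : form p.1 m < 0 := by rw [← hpe, form_ray]; linarith
  have hclamp : ∀ s : ℝ, max 0 (min s D) ∈ Icc 0 D := fun s =>
    ⟨le_max_left _ _, max_le hD.le (min_le_right _ _)⟩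
  have hclamp_eq : ∀ s ∈ Icc 0 D, max 0 (min s D) = s := fun s hs => by
    rw [min_eq_left hs.2, max_eq_right hs.1]
  -- The parameter is clamped to [0, D] so that every value is in the core.
  let β : ℝ → core Γ := fun s => ⟨⟦ray p n hp (max 0 (min s D))⟧,
    mk_mem_core_iff.mpr (ray_mem_hull hp hpH (by rw [hqe]; exact hqH) (hclamp s))⟩
  have hβ : ∀ s ∈ Icc 0 D, (β s).1 = ⟦ray p n hp s⟧ := fun s hs => by
    simp only [β, hclamp_eq s hs]
  obtain ⟨ε₁, hε₁, b₁⟩ := exists_le_mdist_coreBoundary hd hbn hp hqH hqn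
  obtain ⟨ε₂, hε₂, b₂⟩ := exists_le_mdist_coreBoundary hd hbm hq hpH hpm
  refine hasClosedGeodesic_of_arc (β := β) hD (lt_min hε₁ hε₂) ?_ ?_ ?_ ?_ ?_
  · intro t _
    obtain ⟨ε, hε, h⟩ := exists_mdist_eq_hdist htf (ray p n hp t)
    refine ⟨ε, hε, fun s hs s' hs' h1 h2 => ?_⟩
    rw [hβ s hs, hβ s' hs', h, hdist_ray]
    · rwa [hdist_ray, abs_sub_comm]
    · rwa [hdist_ray, abs_sub_comm]
  · rw [hβ 0 ⟨le_rfl, hD.le⟩, ray_zero]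
    exact mk_mem_coreBoundary hpH (notMem_interior_hull hln hp)
  · rw [hβ D ⟨hD.le, le_rfl⟩, hqe]
    exact mk_mem_coreBoundary hqH (notMem_interior_hull hlm hq)
  · intro s hs hsε z hz hzb
    rw [hβ s hs]
    exact b₁ s hs.1 (hsε.trans_le (min_le_left _ _)) z hz hzb
  · intro s hs hsε z hz hzb
    rw [hβ (D - s) ⟨by linarith [hs.2], by linarith [hs.1]⟩, hpq, sub_sub_cancel]
    exact b₂ s hs.1 (hsε.trans_le (min_le_right _ _)) z hz hzb

end DoubleGeodesic

/-! ### Thickness of the return times -/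

section Thickness

variable {d : ℕ} {Γ : Subgroup (G d)}

/-- Two null vectors `a`, `b` of product `-1` and a vector `w` orthogonal to both: the points
`b + s w + s² Q(w) / 2 a` form a horocyclic orbit at infinity. -/
structure IsHorocyclicFrame (a b w : Vec d) : Prop where
  null_left : form a a = 0
  null_right : form b b = 0
  form_eq : form a b = -1
  orth_left : form w a = 0
  orth_right : form w b = 0
  ht_left : 0 < ht a
  ht_right : 0 < ht b

/-- The horocyclic orbit of a frame. -/
def horocycle (a b w : Vec d) (s : ℝ) : Vec d := b + s • w + (s ^ 2 * form w w / 2) • a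

lemma form_horocycle (a b w n : Vec d) (s : ℝ) :
    form (horocycle a b w s) n = form b n + s * form w n + s ^ 2 * form w w / 2 * form a n := by
  simp only [horocycle, form_add_left, form_smul_left]

namespace IsHorocyclicFrame

variable {a b w : Vec d} (h : IsHorocyclicFrame a b w)

include h

lemma timelike : form (a + b) (a + b) = -2 := by
  simp only [form_add_left, form_add_right, h.null_left, h.null_right, form_comm b a, h.form_eq]
  norm_num

lemma ht_add_pos : 0 < ht (a + b) := by
  rw [ht_add]
  exact add_pos h.ht_left h.ht_right

lemma horocycle_null (s : ℝ) : form (horocycle a b w s) (horocycle a b w s) = 0 := by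
  simp only [horocycle, form_add_left, form_add_right, form_smul_left, form_smul_right,
    h.null_left, h.null_right, form_comm b a, form_comm a w, form_comm b w, h.form_eq,
    h.orth_left, h.orth_right]
  ring

lemma form_self_nonneg : 0 ≤ form w w :=
  form_self_nonneg_of_orthogonal (by rw [h.timelike]; norm_num)
    (by rw [form_add_right, h.orth_left, h.orth_right, add_zero])

lemma eq_zero_of_form_self (h0 : form w w = 0) : w = 0 := by
  by_contra hw
  have := form_self_pos_of_orthogonal (by rw [h.timelike]; norm_num)
    (by rw [form_add_right, h.orth_left, h.orth_right, add_zero]) hw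
  exact this.ne' h0

lemma ht_horocycle_pos (s : ℝ) : 0 < ht (horocycle a b w s) := by
  refine ht_pos_of_form_neg (h.horocycle_null s).le (by rw [h.timelike]; norm_num) h.ht_add_pos ?_
  simp only [horocycle, form_add_left, form_add_right, form_smul_left,
    h.null_left, h.null_right, form_comm b a, h.form_eq, h.orth_left, h.orth_right]
  have := h.form_self_nonneg
  nlinarith [mul_nonneg (sq_nonneg s) this]

lemma mulVec (g : G d) :
    IsHorocyclicFrame (g.mat.mulVec a) (g.mat.mulVec b) (g.mat.mulVec w) where
  null_left := by rw [form_mat, h.null_left]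
  null_right := by rw [form_mat, h.null_right]
  form_eq := by rw [form_mat, h.form_eq]
  orth_left := by rw [form_mat, h.orth_left]
  orth_right := by rw [form_mat, h.orth_right]
  ht_left := ht_mulVec_pos g h.null_left.le h.ht_left
  ht_right := ht_mulVec_pos g h.null_right.le h.ht_right

/-- The component of `n` orthogonal to `a`, `b` and `w` has nonnegative norm. For `w = 0` the
quotient has the default value 0, and only `a` and `b` are projected away. -/
lemma weight_le {n : Vec d} (hn : form n n = 1) :
    form w n ^ 2 / form w w ≤ 1 + 2 * (form a n * form b n) := by
  rcases h.form_self_nonneg.eq_or_lt with hw | hw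
  · rw [h.eq_zero_of_form_self hw.symm, form_zero_left, form_zero_left]
    have h1 := form_self_nonneg_of_orthogonal (y := a + b)
      (w := n + form b n • a + form a n • b) (by rw [h.timelike]; norm_num) (by
        simp only [form_add_left, form_add_right, form_smul_left, h.null_left, h.null_right,
          form_comm b a, h.form_eq, form_comm n]
        ring)
    simp only [form_add_left, form_add_right, form_smul_left, form_smul_right, h.null_left,
      h.null_right, form_comm b a, h.form_eq, form_comm n a, form_comm n b, hn] at h1
    simp only [zero_pow two_ne_zero, zero_div]
    linarith
  · have h1 := form_self_nonneg_of_orthogonal (y := a + b)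
      (w := n + form b n • a + form a n • b - (form w n / form w w) • w)
      (by rw [h.timelike]; norm_num) (by
        simp only [form_add_left, form_sub_left, form_add_right, form_smul_left, h.null_left,
          h.null_right, form_comm b a, h.form_eq, form_comm n, h.orth_left, h.orth_right]
        ring)
    simp only [form_add_left, form_sub_left, form_add_right, form_sub_right, form_smul_left,
      form_smul_right, h.null_left, h.null_right, form_comm b a, form_comm a w, form_comm b w,
      h.form_eq, form_comm n a, form_comm n b, form_comm n w, hn, h.orth_left, h.orth_right] at h1
    have e : form w n / form w w * form w n = form w n ^ 2 / form w w := by ring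
    have e2 : form w n / form w w * (form w n / form w w * form w w) =
        form w n ^ 2 / form w w := by field_simp
    linarith

/-- The same decomposition applied to `n + m`, of norm `2 + 2 form n m`, with the nonnegative
`w`-term dropped. -/
lemma neg_form_le_add {n m : Vec d} (hw : 0 < form w w) (hn : form n n = 1) (hm : form m m = 1) :
    -form n m ≤ 1 + (form a n + form a m) * (form b n + form b m) := by
  have h1 := form_self_nonneg_of_orthogonal (y := a + b)
    (w := (n + m) + form b (n + m) • a + form a (n + m) • b -
      (form w (n + m) / form w w) • w)
    (by rw [h.timelike]; norm_num) (by
      simp only [form_add_left, form_sub_left, form_add_right, form_smul_left, h.null_left,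
        h.null_right, form_comm b a, h.form_eq, form_comm n, form_comm m, h.orth_left,
        h.orth_right]
      ring)
  obtain ⟨z, hz⟩ : ∃ z, z = n + m := ⟨_, rfl⟩
  have hzz : form z z = 2 + 2 * form n m := by
    simp only [hz, form_add_left, form_add_right, hn, hm, form_comm m n]; ring
  rw [← hz] at h1
  rw [← form_add_right, ← form_add_right, ← hz]
  simp only [form_add_left, form_sub_left, form_add_right, form_sub_right, form_smul_left,
    form_smul_right, h.null_left, h.null_right, form_comm b a, form_comm a w, form_comm b w,
    h.form_eq, form_comm z a, form_comm z b, form_comm z w, hzz, h.orth_left, h.orth_right] at h1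
  have e : form w z / form w w * form w z = form w z ^ 2 / form w w := by ring
  have e2 : form w z / form w w * (form w z / form w w * form w w) =
      form w z ^ 2 / form w w := by field_simp
  have e3 : 0 ≤ form w z ^ 2 / form w w := by positivity
  linarith

/-- If a round ball contains the arc `[r, k r]` of a horocyclic orbit and another one the arc
`[-k r, -r]`, their boundary hyperplanes are close. -/
lemma neg_form_le {n m : Vec d} (hw : 0 < form w w) (hn : form n n = 1) (hm : form m m = 1)
    (han : form a n ≤ 0) (ham : form a m ≤ 0) (hbn : form b n ≤ 0) (hbm : form b m ≤ 0)
    {k r : ℝ} (hk : 4 < k) (hr : 0 < r)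
    (h1 : 0 < form (horocycle a b w r) n) (h2 : 0 < form (horocycle a b w (k * r)) n)
    (h3 : 0 < form (horocycle a b w (-r)) m) (h4 : 0 < form (horocycle a b w (-(k * r))) m) :
    -form n m ≤ 1 + 8 / (k - 4) := by
  rw [form_horocycle] at h1 h2 h3 h4
  have hkr : 0 < k * r := by positivity
  set ρ := form w w
  -- At `r` the quadratic term is dropped, at `k r` the constant term. The normal `m` obeys the same
  -- inequalities after `s ↦ -s`, that is with `Ω = -form w m`.
  have a1 : ∀ A B Ω : ℝ, A ≤ 0 → B ≤ 0 → 0 < B + r * Ω + r ^ 2 * ρ / 2 * A →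
      0 < B + k * r * Ω + (k * r) ^ 2 * ρ / 2 * A → -B < r * Ω ∧ -A * (k * r * ρ) < 2 * Ω := by
    intro A B Ω hA hB b1 b2
    constructor
    · have : r ^ 2 * ρ / 2 * A ≤ 0 := mul_nonpos_of_nonneg_of_nonpos (by positivity) hA
      linarith
    · have b3 : 0 < k * r * (Ω + k * r * ρ / 2 * A) := by linarith
      have := pos_of_mul_pos_right b3 hkr.le
      linarith
  obtain ⟨c1, c2⟩ := a1 _ _ _ han hbn h1 h2
  obtain ⟨c3, c4⟩ := a1 (form a m) (form b m) (-form w m) ham hbm (by linarith) (by linarith)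
  have key : ∀ A B Ω : ℝ, A ≤ 0 → B ≤ 0 → -B < r * Ω → -A * (k * r * ρ) < 2 * Ω →
      A * B ≤ 2 / k * (Ω ^ 2 / ρ) := by
    intro A B Ω hA hB d1 d2
    have e : 2 / k * (Ω ^ 2 / ρ) = (2 * Ω / (k * r * ρ)) * (r * Ω) := by field_simp
    rw [e, ← neg_mul_neg]
    refine mul_le_mul ?_ d1.le (by linarith) ?_
    · rw [le_div_iff₀ (by positivity)]; exact d2.le
    · refine div_nonneg ?_ (by positivity)
      have : 0 ≤ -A * (k * r * ρ) := mul_nonneg (by linarith) (by positivity)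
      linarith
  -- Inserting `P ≤ 2 W / k` into `W ≤ 1 + 2 P` gives `W (1 - 4 / k) ≤ 1`, whence the condition `4 <
  -- k`.
  have bound : ∀ W P : ℝ, P ≤ 2 / k * W → W ≤ 1 + 2 * P → W ≤ k / (k - 4) := by
    intro W P d1 d2
    rw [le_div_iff₀ (by linarith)]
    have e : 2 / k * W * k = 2 * W := by field_simp
    have : P * k ≤ 2 * W := by rw [← e]; exact mul_le_mul_of_nonneg_right d1 (by linarith)
    nlinarith
  have w1 := bound _ _ (key _ _ _ han hbn c1 c2) (h.weight_le hn)
  have w2 := bound _ _ (key _ _ _ ham hbm c3 c4) (by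
    rw [neg_sq]; exact h.weight_le hm)
  -- The inequalities for `n` and `m` are linear in `(A, B, Ω)`, so their sums satisfy them too.
  have p := key (form a n + form a m) (form b n + form b m) (form w n + -form w m)
    (by linarith) (by linarith) (by linarith) (by linarith)
  have q : (form w n + -form w m) ^ 2 / ρ ≤ 4 * (k / (k - 4)) := by
    have : (form w n + -form w m) ^ 2 ≤ 2 * form w n ^ 2 + 2 * (-form w m) ^ 2 := by
      nlinarith [sq_nonneg (form w n - -form w m)]
    calc (form w n + -form w m) ^ 2 / ρ ≤ (2 * form w n ^ 2 + 2 * (-form w m) ^ 2) / ρ := by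
          gcongr
      _ = 2 * (form w n ^ 2 / ρ) + 2 * ((-form w m) ^ 2 / ρ) := by ring
      _ ≤ _ := by linarith
  have f := h.neg_form_le_add hw hn hm
  have k0 : 0 < k := by linarith
  have k4 : 0 < k - 4 := by linarith
  have e : 2 / k * (4 * (k / (k - 4))) = 8 / (k - 4) := by field_simp; norm_num
  have : 2 / k * ((form w n + -form w m) ^ 2 / ρ) ≤ 8 / (k - 4) := by
    rw [← e]; gcongr
  linarith

end IsHorocyclicFrame

/-- A connected set covered by disjoint positivity sets lies in one of them. -/
lemma exists_forall_pos_of_isPreconnected {ι : Type*} {f : ι → ℝ → ℝ} (hf : ∀ i, Continuous (f i))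
    (hdis : ∀ i j s, 0 < f i s → 0 < f j s → i = j) {S : Set ℝ} (hS : IsPreconnected S)
    (hne : S.Nonempty) (hcov : ∀ s ∈ S, ∃ i, 0 < f i s) : ∃ i, ∀ s ∈ S, 0 < f i s := by
  obtain ⟨s₀, hs₀⟩ := hne
  obtain ⟨i, hi⟩ := hcov s₀ hs₀
  have hopen : ∀ j, IsOpen {s | 0 < f j s} := fun j => isOpen_lt continuous_const (hf j)
  have hsub := IsPreconnected.subset_left_of_subset_union (hopen i)
    (isOpen_iUnion fun j : {j // j ≠ i} => hopen j)
    (disjoint_left.mpr fun s hs hs' => by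
      obtain ⟨j, hj⟩ := mem_iUnion.mp hs'
      exact j.2 (hdis _ _ s hj hs))
    (fun s hs => by
      obtain ⟨j, hj⟩ := hcov s hs
      by_cases hji : j = i
      · exact Or.inl (hji ▸ hj)
      · exact Or.inr (mem_iUnion.mpr ⟨⟨j, hji⟩, hj⟩)) ⟨s₀, hs₀, hi⟩ hS
  exact ⟨i, fun s hs => hsub hs⟩

lemma continuous_horocycle (a b w : Vec d) : Continuous (horocycle a b w) := by
  unfold horocycle; fun_prop

/-- Horocyclic orbits with base point in the limit set meet it in every symmetric pair of long
intervals around a point of the limit set. -/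
lemma exists_mem_limitSet_horocycle (hd : 2 ≤ d) (hΓ : IsConvexCocompactFuchsianEnds Γ) {η : ℝ}
    (hη : IsSystoleOfDouble Γ η) {a b w : Vec d} (h : IsHorocyclicFrame a b w)
    (ha : klein a ∈ limitSet Γ) (hb : klein b ∈ limitSet Γ) {k r : ℝ} (hk : 4 < k)
    (hkη : 1 + 8 / (k - 4) < Real.cosh (η / 2)) (hr : 0 < r) :
    ∃ s ∈ Icc (-(k * r)) (-r) ∪ Icc r (k * r), klein (horocycle a b w s) ∈ limitSet Γ := by
  have hrk : r ≤ k * r := by nlinarith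
  rcases h.form_self_nonneg.eq_or_lt with hw | hw
  -- For `w = 0` the orbit is constant at `b`.
  · refine ⟨r, Or.inr ⟨le_rfl, hrk⟩, ?_⟩
    rw [horocycle, h.eq_zero_of_form_self hw.symm, form_zero_left]
    simpa using hb
  have := hΓ.discrete
  obtain ⟨n, hn, hunion, hdis, -⟩ := hΓ.exists_balls
  have hball : ∀ i, ∀ ξ ∈ roundBall (n i), ξ ∉ limitSet Γ := by
    intro i ξ hξ
    have : ξ ∈ sphereInf d \ limitSet Γ := by rw [hunion]; exact mem_iUnion.mpr ⟨i, hξ⟩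
    exact this.2
  have hle : ∀ i, ∀ ξ ∈ limitSet Γ, form ξ (n i) ≤ 0 := by
    intro i ξ hξ
    by_contra! hpos
    exact hball i ξ ⟨hξ.1, hpos⟩ hξ
  have heq : ∀ i j ξ, ξ ∈ closure (roundBall (n i)) → ξ ∈ closure (roundBall (n j)) → i = j := by
    intro i j ξ hi hj
    by_contra hij
    exact disjoint_left.mp (hdis hij) hi hj
  -- A boundary point of a ball outside `Λ` would lie in some ball; disjointness of closures makes
  -- it the same ball, which is open.
  have hbd : ∀ i, ∀ ξ ∈ sphereInf d, form ξ (n i) = 0 → ξ ∈ limitSet Γ := by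
    intro i ξ hξ h0
    by_contra hξΛ
    have : ξ ∈ ⋃ i, roundBall (n i) := by rw [← hunion]; exact ⟨hξ, hξΛ⟩
    obtain ⟨j, hj⟩ := mem_iUnion.mp this
    obtain rfl := heq i j ξ (mem_closure_roundBall (hn i) hξ h0.ge) (subset_closure hj)
    exact hj.2.ne' h0
  have hle' : ∀ i v, 0 < ht v → klein v ∈ limitSet Γ → form v (n i) ≤ 0 := by
    intro i v hv hvΛ
    have h1 := hle i _ hvΛ
    rw [← smul_klein hv.ne', form_smul_left]
    exact mul_nonpos_of_nonneg_of_nonpos hv.le h1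
  have hsph : ∀ s, klein (horocycle a b w s) ∈ sphereInf d := fun s =>
    klein_mem_sphereInf (h.horocycle_null s) (h.ht_horocycle_pos s).ne'
  have hpos : ∀ s i, 0 < form (horocycle a b w s) (n i) →
      klein (horocycle a b w s) ∈ roundBall (n i) := fun s i hi =>
    ⟨hsph s, by rw [form_klein_left]; exact mul_pos (inv_pos.mpr (h.ht_horocycle_pos s)) hi⟩
  by_contra! hno
  have hcov : ∀ s ∈ Icc (-(k * r)) (-r) ∪ Icc r (k * r),
      ∃ i, 0 < form (horocycle a b w s) (n i) := by
    intro s hs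
    have : klein (horocycle a b w s) ∈ ⋃ i, roundBall (n i) := by
      rw [← hunion]; exact ⟨hsph s, hno s hs⟩
    obtain ⟨i, hi⟩ := mem_iUnion.mp this
    refine ⟨i, ?_⟩
    rw [← smul_klein (h.ht_horocycle_pos s).ne', form_smul_left]
    exact mul_pos (h.ht_horocycle_pos s) hi.2
  have hcont : ∀ i, Continuous fun s => form (horocycle a b w s) (n i) := fun i =>
    continuous_form (continuous_horocycle a b w) continuous_const
  have hdisj : ∀ i j s, 0 < form (horocycle a b w s) (n i) →
      0 < form (horocycle a b w s) (n j) → i = j := fun i j s hi hj =>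
    heq i j _ (subset_closure (hpos s i hi)) (subset_closure (hpos s j hj))
  obtain ⟨i, hi⟩ := exists_forall_pos_of_isPreconnected hcont hdisj isPreconnected_Icc
    ⟨r, le_rfl, hrk⟩ fun s hs => hcov s (Or.inr hs)
  obtain ⟨j, hj⟩ := exists_forall_pos_of_isPreconnected hcont hdisj isPreconnected_Icc
    ⟨-r, neg_le_neg hrk, le_rfl⟩ fun s hs => hcov s (Or.inl hs)
  have hi1 := hi r ⟨le_rfl, hrk⟩
  have hj1 := hj (-r) ⟨neg_le_neg hrk, le_rfl⟩
  have hai := hle' i a h.ht_left ha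
  have hbi := hle' i b h.ht_right hb
  have haj := hle' j a h.ht_left ha
  have hbj := hle' j b h.ht_right hb
  -- The values at `r` and `-r` add up to `2 form b n + r² Q(w) form a n ≤ 0`, so they are not both
  -- positive for the same normal.
  have hij : i ≠ j := by
    rintro rfl
    rw [form_horocycle] at hi1 hj1
    have : r ^ 2 * form w w / 2 * form a (n i) ≤ 0 :=
      mul_nonpos_of_nonneg_of_nonpos (by positivity) hai
    nlinarith
  have hbound := h.neg_form_le hw (hn i) (hn j) hai haj hbi hbj hk hr hi1
    (hi _ ⟨hrk, le_rfl⟩) hj1 (hj _ ⟨le_rfl, neg_le_neg hrk⟩)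
  obtain ⟨D, hD, hcosh, hgeo⟩ := exists_hasClosedGeodesic hd hΓ.torsionFree (hn i) (hn j)
    (hdis hij) (hbd i) (hbd j) (hle i) (hle j)
  have hle2 : η ≤ 2 * D := hη.2 hgeo
  have hη0 : 0 < η := hη.1.1
  have : Real.cosh (η / 2) ≤ Real.cosh D := by
    rw [Real.cosh_le_cosh, abs_of_pos (by linarith), abs_of_pos hD]
    linarith
  linarith

/-! ### End points of frames and RF M -/

lemma null_fst : form (Pi.single (fstI d) 1 : Vec d) (Pi.single (fstI d) 1) = 0 := by
  simp [form]

lemma null_lst : form (Pi.single (lstI d) 1 : Vec d) (Pi.single (lstI d) 1) = 0 := by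
  simp [form]

lemma ht_fst : ht (Pi.single (fstI d) 1 : Vec d) = 1 := by simp [ht]

lemma ht_lst : ht (Pi.single (lstI d) 1 : Vec d) = -1 := by simp [ht]

lemma minus_eq (g : G d) : g.minus = klein (g.mat.mulVec (-Pi.single (lstI d) 1)) := by
  rw [Matrix.mulVec_neg, ← neg_one_smul ℝ (g.mat.mulVec _), klein_smul (by norm_num)]
  rfl

/-- Invariance of `Λ` makes the condition independent of the representative. The vector `-e_{d+1}`
represents the same line as `e_{d+1}` but has positive height, as a horocyclic frame requires. -/
lemma mk_mem_RF_iff {g : G d} :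
    (⟦g⟧ : FrameBundle Γ) ∈ RF Γ ↔ klein (g.mat.mulVec (Pi.single (fstI d) 1)) ∈ limitSet Γ ∧
      klein (g.mat.mulVec (-Pi.single (lstI d) 1)) ∈ limitSet Γ := by
  rw [← minus_eq]
  constructor
  · rintro ⟨g', ⟨h1, h2⟩, hg⟩
    obtain ⟨γ, rfl⟩ : ∃ γ : Γ, γ • g = g' := by
      rw [Quotient.eq] at hg
      exact MulAction.orbitRel_apply.mp hg
    have key : ∀ v : Vec d, form v v = 0 → 0 < ht v →
        klein ((γ • g).mat.mulVec v) ∈ limitSet Γ → klein (g.mat.mulVec v) ∈ limitSet Γ := by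
      intro v hv hv0 hmem
      rw [show (γ • g).mat = (γ : G d).mat * g.mat from rfl, ← Matrix.mulVec_mulVec,
        klein_mulVec_mem_limitSet_iff γ.2 (by rw [form_mat, hv])
          (ht_mulVec_pos g hv.le hv0).ne'] at hmem
      exact hmem
    refine ⟨key _ null_fst (by rw [ht_fst]; norm_num) h1, ?_⟩
    rw [minus_eq] at h2 ⊢
    exact key _ (by rw [form_neg_left, form_neg_right, null_lst]; norm_num)
      (by rw [ht_neg, ht_lst]; norm_num) h2
  · exact fun h => ⟨g, h, rfl⟩

/-- Global thickness of the return times of a one-parameter group that fixes one of two null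
vectors and moves the other one along a horocyclic orbit. -/
lemma globallyThick_of_horocycle (hd : 2 ≤ d) (hΓ : IsConvexCocompactFuchsianEnds Γ) {η : ℝ}
    (hη : IsSystoleOfDouble Γ η) {a b w : Vec d} (h : IsHorocyclicFrame a b w)
    (hRF : ∀ g : G d, (⟦g⟧ : FrameBundle Γ) ∈ RF Γ ↔
      klein (g.mat.mulVec a) ∈ limitSet Γ ∧ klein (g.mat.mulVec b) ∈ limitSet Γ)
    {u : ℝ → G d} (hu : ∀ s t, u (s + t) = u s * u t) (hua : ∀ s, (u s).mat.mulVec a = a)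
    (hub : ∀ s, (u s).mat.mulVec b = horocycle a b w s) {k : ℝ} (hk : 4 < k)
    (hkη : 1 + 8 / (k - 4) < Real.cosh (η / 2)) {y : FrameBundle Γ} (hy : y ∈ RF Γ) :
    GloballyThick k (returnTimes u y) := by
  obtain ⟨g, rfl⟩ := Quotient.exists_rep y
  have hg := (hRF g).mp hy
  have hmul : ∀ (g : G d) t, g.mat.mulVec (horocycle a b w t) =
      horocycle (g.mat.mulVec a) (g.mat.mulVec b) (g.mat.mulVec w) t := by
    intro g t
    simp only [horocycle, mulVec_add', mulVec_smul', form_mat]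
  have hmem : ∀ (g : G d) t, klein (g.mat.mulVec a) ∈ limitSet Γ →
      ((⟦g * u t⟧ : FrameBundle Γ) ∈ RF Γ ↔
        klein (horocycle (g.mat.mulVec a) (g.mat.mulVec b) (g.mat.mulVec w) t) ∈
          limitSet Γ) := by
    intro g t hga
    rw [hRF, mulVec_mul, mulVec_mul, hua, hub, hmul]
    exact and_iff_right hga
  have hT : returnTimes u (⟦g⟧ : FrameBundle Γ) = {t | klein (horocycle (g.mat.mulVec a)
      (g.mat.mulVec b) (g.mat.mulVec w) t) ∈ limitSet Γ} := by
    ext t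
    exact hmem g t hg.1
  refine ⟨?_, ⟨0, ?_⟩, fun t ht r hr => ?_⟩
  · rw [hT]
    refine (isClosed_limitSet Γ).preimage (continuous_iff_continuousAt.mpr fun t => ?_)
    exact (continuousAt_klein ((h.mulVec g).ht_horocycle_pos t).ne').comp_of_eq
      (continuous_horocycle _ _ _).continuousAt rfl
  · rw [hT, mem_ofPred_eq]
    simpa [horocycle] using hg.2
  -- Replacing `g` by `g u_t` reduces thickness at `t` to thickness at 0.
  · have ht' : (⟦g * u t⟧ : FrameBundle Γ) ∈ RF Γ := ht
    have hgt := (hRF _).mp ht'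
    obtain ⟨s, hs, hsΛ⟩ := exists_mem_limitSet_horocycle hd hΓ hη (h.mulVec (g * u t)) hgt.1 hgt.2
      hk hkη hr
    refine ⟨t + s, ?_, ?_⟩
    · change (⟦g * u (t + s)⟧ : FrameBundle Γ) ∈ RF Γ
      rw [hu, ← mul_assoc]
      exact (hmem (g * u t) s hgt.1).mpr hsΛ
    · rcases hs with hs | hs
      · exact Or.inl ⟨by linarith [hs.1], by linarith [hs.2]⟩
      · exact Or.inr ⟨by linarith [hs.1], by linarith [hs.2]⟩

/-! ### One-parameter subgroups of the horospherical groups -/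

lemma exp_mulVec_of_nilpotent {A : Matrix (Idx d) (Idx d) ℝ}
    (hA : ∀ v, A.mulVec (A.mulVec (A.mulVec v)) = 0) (v : Vec d) :
    (NormedSpace.exp A).mulVec v = v + A.mulVec v + (1 / 2 : ℝ) • A.mulVec (A.mulVec v) := by
  have h3 : A ^ 3 = 0 := by
    refine Matrix.mulVec_injective (funext fun v => ?_)
    rw [pow_succ, pow_two, ← Matrix.mulVec_mulVec, ← Matrix.mulVec_mulVec, hA, Matrix.zero_mulVec]
  have hz : ∀ n ∉ Finset.range 3, ((n.factorial : ℝ)⁻¹) • A ^ n = 0 := by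
    intro n hn
    rw [Finset.mem_range, not_lt] at hn
    rw [pow_eq_zero_of_le hn h3, smul_zero]
  rw [NormedSpace.exp_eq_tsum ℝ]
  change (∑' n : ℕ, ((n.factorial : ℝ)⁻¹) • A ^ n).mulVec v = _
  rw [tsum_eq_sum hz]
  simp only [Finset.sum_range_succ, Finset.sum_range_zero, Nat.factorial, pow_zero, pow_one,
    Matrix.add_mulVec, Matrix.smul_mulVec, pow_two, ← Matrix.mulVec_mulVec, Matrix.one_mulVec]
  norm_num

/-- The vector with given middle block. -/
def midVec (x : Fin (d - 1) → ℝ) : Vec d := Sum.elim (fun _ => 0) (Sum.elim x fun _ => 0)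

lemma form_midVec (x : Fin (d - 1) → ℝ) : form (midVec x) (midVec x) = ∑ i, x i * x i := by
  simp [form, midVec]

lemma uMinus_mulVec (x : Fin (d - 1) → ℝ) (v : Vec d) : (uMinus x).mulVec v =
    (∑ i, x i * v (midI i)) • Pi.single (fstI d) 1 - v (lstI d) • midVec x := by
  funext i
  rcases i with ⟨⟩ | i | ⟨⟩ <;>
    simp [Matrix.mulVec, dotProduct, uMinus, midVec, mul_comm]

lemma uPlus_mulVec (x : Fin (d - 1) → ℝ) (v : Vec d) : (uPlus x).mulVec v =
    v (fstI d) • midVec x - (∑ i, x i * v (midI i)) • Pi.single (lstI d) 1 := by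
  funext i
  rcases i with ⟨⟩ | i | ⟨⟩ <;>
    simp [Matrix.mulVec, dotProduct, uPlus, midVec, mul_comm]

lemma exp_uMinus_fst (x : Fin (d - 1) → ℝ) :
    (NormedSpace.exp (uMinus x)).mulVec (Pi.single (fstI d) 1) = Pi.single (fstI d) 1 := by
  rw [exp_mulVec_of_nilpotent (fun v => by simp [uMinus_mulVec, midVec])]
  simp [-Matrix.mulVec_single, uMinus_mulVec]

lemma exp_uMinus_lst (x : Fin (d - 1) → ℝ) :
    (NormedSpace.exp (uMinus x)).mulVec (-Pi.single (lstI d) 1) =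
      -Pi.single (lstI d) 1 + midVec x + (form (midVec x) (midVec x) / 2) •
        Pi.single (fstI d) 1 := by
  rw [exp_mulVec_of_nilpotent (fun v => by simp [uMinus_mulVec, midVec]), form_midVec]
  simp [-Matrix.mulVec_single, uMinus_mulVec, midVec, smul_smul]
  ring_nf

lemma exp_uPlus_lst (x : Fin (d - 1) → ℝ) :
    (NormedSpace.exp (uPlus x)).mulVec (-Pi.single (lstI d) 1) = -Pi.single (lstI d) 1 := by
  rw [exp_mulVec_of_nilpotent (fun v => by simp [uPlus_mulVec, midVec])]
  simp [-Matrix.mulVec_single, uPlus_mulVec]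

lemma exp_uPlus_fst (x : Fin (d - 1) → ℝ) :
    (NormedSpace.exp (uPlus x)).mulVec (Pi.single (fstI d) 1) =
      Pi.single (fstI d) 1 + midVec x + (form (midVec x) (midVec x) / 2) •
        (-Pi.single (lstI d) 1) := by
  rw [exp_mulVec_of_nilpotent (fun v => by simp [uPlus_mulVec, midVec]), form_midVec]
  simp [-Matrix.mulVec_single, uPlus_mulVec, midVec, smul_smul]
  ring_nf

lemma isHorocyclicFrame_minus (x : Fin (d - 1) → ℝ) :
    IsHorocyclicFrame (Pi.single (fstI d) 1) (-Pi.single (lstI d) 1) (midVec x) where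
  null_left := null_fst
  null_right := by rw [form_neg_left, form_neg_right, null_lst]; norm_num
  form_eq := by simp [form]
  orth_left := by simp [form, midVec]
  orth_right := by simp [form, midVec]
  ht_left := by rw [ht_fst]; norm_num
  ht_right := by rw [ht_neg, ht_lst]; norm_num

lemma isHorocyclicFrame_plus (x : Fin (d - 1) → ℝ) :
    IsHorocyclicFrame (-Pi.single (lstI d) 1) (Pi.single (fstI d) 1) (midVec x) where
  null_left := (isHorocyclicFrame_minus x).null_right
  null_right := null_fst
  form_eq := by rw [form_comm, (isHorocyclicFrame_minus x).form_eq]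
  orth_left := (isHorocyclicFrame_minus x).orth_right
  orth_right := (isHorocyclicFrame_minus x).orth_left
  ht_left := (isHorocyclicFrame_minus x).ht_right
  ht_right := (isHorocyclicFrame_minus x).ht_left

/-- A one-parameter group that fixes `a` and moves `b` along horocyclic orbits does so with
constant velocity. -/
lemma exists_horocycle_of_isOneParameterSubgroup {a b : Vec d} {u : ℝ → G d}
    (hu : IsOneParameterSubgroup u) (hb : ∀ i : Fin (d - 1), b (midI i) = 0)
    (ha : ∀ i : Fin (d - 1), a (midI i) = 0) {x : ℝ → Fin (d - 1) → ℝ}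
    (hfa : ∀ s, (u s).mat.mulVec a = a)
    (hmid : ∀ s t (i : Fin (d - 1)), (u s).mat.mulVec (midVec (x t)) (midI i) = x t i)
    (hfb : ∀ s, (u s).mat.mulVec b = b + midVec (x s) +
      (form (midVec (x s)) (midVec (x s)) / 2) • a) :
    ∃ v, ∀ s, (u s).mat.mulVec b = horocycle a b (midVec v) s := by
  have hval : ∀ s i, (u s).mat.mulVec b (midI i) = x s i := by
    intro s i
    rw [hfb]
    simp [hb, ha, midVec]
  -- The middle block of `u_s u_t b` is `x s + x t`, because `a` has no middle block and `u_s` keeps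
  -- the middle block of `midVec (x t)`.
  have hadd : ∀ s t, x (s + t) = x s + x t := by
    intro s t
    funext i
    rw [← hval, hu.2, mulVec_mul, hfb t, mulVec_add', mulVec_add', mulVec_smul', hfa]
    simp only [Pi.add_apply, Pi.smul_apply, hval, hmid, ha, smul_zero, add_zero]
  have hcont : Continuous x := by
    refine continuous_pi fun i => ?_
    have h1 : Continuous fun s => (u s).mat.mulVec b (midI i) :=
      (continuous_apply (midI i : Idx d)).comp (Y := Vec d)
        ((isClosedEmbedding_mat.continuous.comp hu.1).matrix_mulVec continuous_const)
    simpa only [hval] using h1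
  let X : ℝ →+ (Fin (d - 1) → ℝ) := AddMonoidHom.mk' x hadd
  have hlin : ∀ s, x s = s • x 1 := by
    intro s
    have h1 := map_real_smul X hcont s 1
    rwa [smul_eq_mul, mul_one] at h1
  refine ⟨x 1, fun s => ?_⟩
  have e : midVec (x s) = s • midVec (x 1) := by
    rw [hlin]
    funext i
    rcases i with ⟨⟩ | i | ⟨⟩ <;> simp [midVec]
  rw [hfb, e, horocycle, form_smul_left, form_smul_right]
  congr 2
  ring

lemma exp_uMinus_midVec (x y : Fin (d - 1) → ℝ) (i : Fin (d - 1)) :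
    (NormedSpace.exp (uMinus x)).mulVec (midVec y) (midI i) = y i := by
  rw [exp_mulVec_of_nilpotent (fun v => by simp [uMinus_mulVec, midVec])]
  simp [uMinus_mulVec, midVec]

lemma exp_uPlus_midVec (x y : Fin (d - 1) → ℝ) (i : Fin (d - 1)) :
    (NormedSpace.exp (uPlus x)).mulVec (midVec y) (midI i) = y i := by
  rw [exp_mulVec_of_nilpotent (fun v => by simp [uPlus_mulVec, midVec])]
  simp [uPlus_mulVec, midVec]

end Thickness

end FuchsianEnds

end

open FuchsianEnds in
theorem proposition4p12 :
    ∃ k : ℝ → ℝ, (∀ η > 0, 1 < k η) ∧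
      ∀ (d : ℕ), 2 ≤ d → ∀ Γ : Subgroup (FuchsianEnds.G d),
        FuchsianEnds.IsConvexCocompactFuchsianEnds Γ →
        ∀ η : ℝ, FuchsianEnds.IsSystoleOfDouble Γ η →
        ∀ u : ℝ → FuchsianEnds.G d, FuchsianEnds.IsOneParameterSubgroup u →
          ((∀ t, u t ∈ FuchsianEnds.NMinus d) ∨ (∀ t, u t ∈ FuchsianEnds.NPlus d)) →
        ∀ y ∈ FuchsianEnds.RF Γ,
          FuchsianEnds.GloballyThick (k η) (FuchsianEnds.returnTimes u y) := by
  have hcosh : ∀ η > 0, 0 < Real.cosh (η / 2) - 1 := fun η hη => by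
    have := Real.one_lt_cosh.mpr (show η / 2 ≠ 0 by positivity)
    linarith
  -- The contradiction needs `8 / (k - 4) < cosh (η / 2) - 1`, that is `k > 4 + 8 / (cosh (η / 2) -
  -- 1)`; the 5 leaves a margin of 1.
  refine ⟨fun η => 5 + 8 / (Real.cosh (η / 2) - 1), fun η hη => ?_, ?_⟩
  · have := div_pos (by norm_num : (0 : ℝ) < 8) (hcosh η hη)
    linarith
  intro d hd Γ hΓ η hη u hu hN y hy
  have hc := hcosh η hη.1.1
  have h8 : 0 < 8 / (Real.cosh (η / 2) - 1) := by positivity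
  have hk : 4 < 5 + 8 / (Real.cosh (η / 2) - 1) := by linarith
  have hkη : 1 + 8 / (5 + 8 / (Real.cosh (η / 2) - 1) - 4) < Real.cosh (η / 2) := by
    have h1 : 8 / (5 + 8 / (Real.cosh (η / 2) - 1) - 4) < Real.cosh (η / 2) - 1 := by
      rw [div_lt_iff₀ (by linarith)]
      have : (Real.cosh (η / 2) - 1) * (8 / (Real.cosh (η / 2) - 1)) = 8 := by field_simp
      nlinarith
    linarith
  rcases hN with hN | hN
  · choose x hx using hN
    obtain ⟨v, hv⟩ := exists_horocycle_of_isOneParameterSubgroup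
      (a := Pi.single (fstI d) 1) (b := -Pi.single (lstI d) 1) (x := x) hu
      (fun i => by simp) (fun i => by simp)
      (fun s => by rw [hx, exp_uMinus_fst]) (fun s t i => by rw [hx, exp_uMinus_midVec])
      (fun s => by rw [hx, exp_uMinus_lst])
    exact globallyThick_of_horocycle hd hΓ hη (isHorocyclicFrame_minus v)
      (fun g => mk_mem_RF_iff) hu.2 (fun s => by rw [hx, exp_uMinus_fst]) hv hk hkη hy
  -- For `N⁺` the roles are exchanged: the backward end point is fixed and the forward one moves.
  · choose x hx using hN
    obtain ⟨v, hv⟩ := exists_horocycle_of_isOneParameterSubgroup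
      (a := -Pi.single (lstI d) 1) (b := Pi.single (fstI d) 1) (x := x) hu
      (fun i => by simp) (fun i => by simp)
      (fun s => by rw [hx, exp_uPlus_lst]) (fun s t i => by rw [hx, exp_uPlus_midVec])
      (fun s => by rw [hx, exp_uPlus_fst])
    exact globallyThick_of_horocycle hd hΓ hη (isHorocyclicFrame_plus v)
      (fun g => mk_mem_RF_iff.trans and_comm) hu.2 (fun s => by rw [hx, exp_uPlus_lst]) hv hk hkη hy
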